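/- Setting. Let $(x_k)_{k\ge 0}$ be a Markov chain with arbitrary initial law on a measurable space $\mathcal X$, with transition kernel $P$ and stationary distribution $\pi$, such that $\|P^k(x,\cdot)-\pi\|_{\mathrm{TV}}\le R r^k$ for all $x\in\mathcal X$, $k\ge 0$, with constants $r\in[0,1)$, $R>0$, where $\|\rho-\rho'\|_{\mathrm{TV}}=\sup_A|\rho(A)-\rho'(A)|$. For $\epsilon>0$ let $\tau_\epsilon=\min\{k\ge 1:\sup_{x}\|P^k(x,\cdot)-\pi\|_{\mathrm{TV}}\le\epsilon\}$. Given $g:\mathbb R^d\times\mathcal X\to\mathbb R^d$, a random initial vector $\theta_0$, a step size $\alpha>0$, random fields $(\xi_k)_{k\ge1}$ on $\mathbb R^d$ and $\beta\in[0,\infty]$, put $$\theta_{k+1/2}=\theta_k+\alpha\big(g(\theta_k,x_k)+\xi_{k+1}(\theta_k)\big),\qquad \theta_{k+1}=\Pi_{\beta}\,\theta_{k+1/2},$$ where $\Pi_\beta$ is the Euclidean projection onto $\{\theta:\|\theta\|\le\beta\}$ ($\Pi_\infty=\mathrm{id}$). Let $\mathcal F_k$ be the $\sigma$-algebra generated by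 $x_t,\theta_t,\xi_{t+1}$ $(t<k)$ and $x_k,\theta_k$; the Markov property of $(x_k)$ is meant with respect to $(\mathcal F_k)$. Let $p\ge 1$ be an integer. Assume: (a) For every $x$, $g(\cdot,x)$ is three times continuously differentiable with bounded derivatives of orders $1,2,3$; there is $L_1>0$ with $\|g^{(i)}(\theta,x)-g^{(i)}(\theta',x)\|\le L_1\|\theta-\theta'\|$ for $i=0,1,2$ and $\|g(0,x)\|\le L_1$, for all $\theta,\theta',x$ (derivatives are taken in $\theta$); $g(\theta,\cdot)$ is measurable for every $\theta$. (b) With $\bar g(\theta)=\mathbb E_{x\sim\pi}[g(\theta,x)]$ there is $\mu>0$, $\mu\le 1-r$, with $\langle\theta-\theta',\bar g(\theta)-\bar g(\theta')\rangle\le-\mu\|\theta-\theta'\|^2$ for all $\theta,\theta'$; and $\theta^*$ is the solution of $\bar g(\theta^*)=0$. (c) The fields $\xi_1,\xi_2,\dots$ are i.i.d., each is measurable jointly in $\theta$ and the outcome with respect to the Borel $\sigma$-algebra of $\mathbb R^d$ and the $\sigma$-algebra generated by the field itself, and $\xi_{k+1}$ is independent of $\mathcal F_k$. For all $\theta$,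 $\mathbb E[\xi_{k+1}(\theta)\mid\mathcal F_k]=0$ and $\mathbb E[\|\xi_1(\theta)\|^{2p}]^{1/(2p)}\le L_2(\|\theta-\theta^*\|+1)$, where $L_2>0$. The map $C(\theta)=\mathbb E[\xi_1(\theta)^{\otimes 2}]$ is twice differentiable, and there are $M,m\ge0$ with $\|C^{(i)}(\theta)\|\le M(1+\|\theta-\theta^*\|^{m})$ for $i=1,2$ and all $\theta$. (d) $L:=L_1+L_2\ge 1$ and $\beta\in[2\|\theta^*\|,\infty]$ (so the unprojected iteration $\beta=\infty$ is included). Proposition. For every integer $p\ge1$ there are constants $c_p\in(0,1]$ and $c_{p,1},c_{p,2}>0$ depending only on $p$, and for every dimension $d$ a finite nonnegative function $s$ of (the law of) $\theta_0$, $\theta^*$, $L$ and $\mu$ only, such that in the above setting, if $\alpha\tau_\alpha L^2\le c_p\,\mu$, then for all $k\ge\tau_\alpha$ $$\mathbb E\|\theta_{k+1}-\theta^*\|^{2p}\le\mathbb E\|\theta_{k+1/2}-\theta^*\|^{2p}\le c_{p,1}(1-\alpha\mu)^{k+1}\,\mathbb E\|\theta_0-\theta^*\|^{2p}+c_{p,2}(\alpha\tau_\alpha)^p\,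 s(\theta_0,\theta^*,L,\mu).$$ The expectations are in $[0,\infty]$. -/

import Mathlib

open MeasureTheory ProbabilityTheory
open scoped ENNReal NNReal

universe u v

noncomputable section

/-- The Euclidean space `ℝ^d`. -/
abbrev Euc (d : ℕ) : Type := EuclideanSpace ℝ (Fin d)

/-! ### Uniformly ergodic Markov chains and mixing times -/

/-- Total variation distance `sup_A |ρ(A) - ρ'(A)|` of two probability measures. -/
def tvDist {X : Type*} [MeasurableSpace X] (ρ ρ' : Measure X) : ℝ :=
  ⨆ A : {A : Set X // MeasurableSet A}, |ρ.real A - ρ'.real A|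

/-- `P` has stationary distribution `π` and `‖P^k(x,·) - π‖_TV ≤ R r^k` for all `x` and `k`.
(The estimate makes the stationary distribution unique.) -/
structure UniformlyErgodic {X : Type*} [MeasurableSpace X]
    (P : Kernel X X) (π : Measure X) (r R : ℝ) : Prop where
  r_nonneg : 0 ≤ r
  r_lt_one : r < 1
  R_pos : 0 < R
  invariant : Kernel.Invariant P π
  tv_le : ∀ (k : ℕ) (x : X), tvDist ((P ^ k) x) π ≤ R * r ^ k

/-- The mixing time `τ_ε = min {k ≥ 1 : sup_x ‖P^k(x,·) - π‖_TV ≤ ε}`. -/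
def mixingTime {X : Type*} [MeasurableSpace X] (P : Kernel X X) (π : Measure X) (ε : ℝ) : ℕ :=
  sInf {k : ℕ | 1 ≤ k ∧ ∀ x : X, tvDist ((P ^ k) x) π ≤ ε}

/-! ### The update function -/

/-- `g(·, x)` is three times continuously differentiable with bounded derivatives of order 1 to 3,
the derivatives of order 0 to 2 are `L₁`-Lipschitz uniformly in `x`, and `‖g(0, x)‖ ≤ L₁`. -/
structure SmoothLinearGrowth {d : ℕ} {X : Type*} (g : Euc d → X → Euc d) (L₁ : ℝ) : Prop where
  L₁_pos : 0 < L₁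
  contDiff : ∀ x, ContDiff ℝ 3 (fun θ => g θ x)
  bounded_deriv : ∀ i : ℕ, 1 ≤ i → i ≤ 3 → ∀ x, ∃ B : ℝ, ∀ θ,
    ‖iteratedFDeriv ℝ i (fun θ => g θ x) θ‖ ≤ B
  lipschitz_deriv : ∀ i : ℕ, i ≤ 2 → ∀ x θ θ',
    ‖iteratedFDeriv ℝ i (fun θ => g θ x) θ - iteratedFDeriv ℝ i (fun θ => g θ x) θ'‖
      ≤ L₁ * ‖θ - θ'‖
  norm_zero_le : ∀ x, ‖g 0 x‖ ≤ L₁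

/-- The averaged update `ḡ(θ) = E_π[g(θ, x)]`. -/
def meanUpdate {d : ℕ} {X : Type*} [MeasurableSpace X] (g : Euc d → X → Euc d) (π : Measure X)
    (θ : Euc d) : Euc d :=
  ∫ x, g θ x ∂π

/-- `⟨θ - θ', h(θ) - h(θ')⟩ ≤ -μ ‖θ - θ'‖²` for all `θ, θ'`, with `μ > 0`. -/
structure StronglyMonotone {d : ℕ} (h : Euc d → Euc d) (μ : ℝ) : Prop where
  μ_pos : 0 < μ
  inner_le : ∀ θ θ', inner ℝ (θ - θ') (h θ - h θ') ≤ -μ * ‖θ - θ'‖ ^ 2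

/-! ### The projected stochastic approximation iteration -/

/-- The projection onto the closed ball of radius `β ∈ [0, ∞]` about the origin;
it is the identity for `β = ∞`. See `projBall_isMin` and `projBall_unique`. -/
def projBall {d : ℕ} (β : ℝ≥0∞) (y : Euc d) : Euc d :=
  open Classical in if ‖y‖ₑ ≤ β then y else (β.toReal / ‖y‖) • y

lemma projBall_mem {d : ℕ} (β : ℝ≥0∞) (y : Euc d) : ‖projBall β y‖ₑ ≤ β := by
  unfold projBall
  split_ifs with h
  · exact h
  · push Not at h
    have hβ : β ≠ ∞ := h.ne_top
    have hy : 0 < ‖y‖ := by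
      rcases (norm_nonneg y).eq_or_lt with h0 | h0
      · rw [← ofReal_norm, ← h0] at h; simp at h
      · exact h0
    have hn : ‖(β.toReal / ‖y‖) • y‖ = β.toReal := by
      rw [norm_smul, Real.norm_of_nonneg (by positivity)]; field_simp
    rw [← ofReal_norm, hn, ENNReal.ofReal_toReal hβ]

/-- `projBall β y` is a point of the ball that is closest to `y` ... -/
lemma projBall_isMin {d : ℕ} (β : ℝ≥0∞) (y z : Euc d) (hz : ‖z‖ₑ ≤ β) :
    ‖projBall β y - y‖ ≤ ‖z - y‖ := by
  unfold projBall
  split_ifs with h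
  · simp
  · push Not at h
    have hβ : β ≠ ∞ := h.ne_top
    have hzr : ‖z‖ ≤ β.toReal := by
      rw [← ofReal_norm] at hz; exact (ENNReal.ofReal_le_iff_le_toReal hβ).1 hz
    have hyr : β.toReal < ‖y‖ := by
      rw [← ofReal_norm] at h; exact (ENNReal.lt_ofReal_iff_toReal_lt hβ).1 h
    have hy : 0 < ‖y‖ := lt_of_le_of_lt ENNReal.toReal_nonneg hyr
    have e : (β.toReal / ‖y‖) • y - y = (β.toReal / ‖y‖ - 1) • y := by rw [sub_smul, one_smul]
    have h1 : β.toReal / ‖y‖ - 1 ≤ 0 := by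
      rw [sub_nonpos, div_le_one hy]; exact hyr.le
    have e2 : ‖(β.toReal / ‖y‖) • y - y‖ = ‖y‖ - β.toReal := by
      rw [e, norm_smul, Real.norm_of_nonpos h1]; field_simp; ring
    have h3 := norm_sub_norm_le y z
    rw [norm_sub_rev] at h3
    linarith

/-- ... and the only one. -/
lemma projBall_unique {d : ℕ} (β : ℝ≥0∞) (y z : Euc d) (hz : ‖z‖ₑ ≤ β)
    (hmin : ‖z - y‖ ≤ ‖projBall β y - y‖) : z = projBall β y := by
  unfold projBall at *
  split_ifs at * with h
  · simpa [sub_eq_zero] using hmin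
  · push Not at h
    have hβ : β ≠ ∞ := h.ne_top
    have hzr : ‖z‖ ≤ β.toReal := by
      rw [← ofReal_norm] at hz; exact (ENNReal.ofReal_le_iff_le_toReal hβ).1 hz
    have hyr : β.toReal < ‖y‖ := by
      rw [← ofReal_norm] at h; exact (ENNReal.lt_ofReal_iff_toReal_lt hβ).1 h
    have hb0 : 0 ≤ β.toReal := ENNReal.toReal_nonneg
    generalize β.toReal = b at *
    have hy : 0 < ‖y‖ := lt_of_le_of_lt hb0 hyr
    have e : (b / ‖y‖) • y - y = (b / ‖y‖ - 1) • y := by rw [sub_smul, one_smul]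
    have h1 : b / ‖y‖ - 1 ≤ 0 := by
      rw [sub_nonpos, div_le_one hy]; exact hyr.le
    have e2 : ‖(b / ‖y‖) • y - y‖ = ‖y‖ - b := by
      rw [e, norm_smul, Real.norm_of_nonpos h1]; field_simp; ring
    rw [e2] at hmin
    have hsq : ‖z - y‖ ^ 2 ≤ (‖y‖ - b) ^ 2 := pow_le_pow_left₀ (norm_nonneg _) hmin 2
    rw [norm_sub_sq_real] at hsq
    have key : ‖z - (b / ‖y‖) • y‖ ^ 2 ≤ 0 := by
      rw [norm_sub_sq_real, inner_smul_right, norm_smul, Real.norm_of_nonneg (by positivity)]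
      set t := b / ‖y‖ with ht
      have htb : t * ‖y‖ = b := by rw [ht]; field_simp
      have ht0 : 0 ≤ t := by positivity
      have hz2 : ‖z‖ ^ 2 ≤ b ^ 2 := pow_le_pow_left₀ (norm_nonneg _) hzr 2
      have h5 : t * (‖z‖ ^ 2 + 2 * b * ‖y‖ - b ^ 2) ≤ t * (2 * inner ℝ z y) :=
        mul_le_mul_of_nonneg_left (by nlinarith) ht0
      have h6 : t * (2 * b * ‖y‖) = 2 * b ^ 2 := by
        calc t * (2 * b * ‖y‖) = 2 * b * (t * ‖y‖) := by ring
          _ = 2 * b ^ 2 := by rw [htb]; ring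
      have h7 : (1 - t) * (‖z‖ ^ 2 - b ^ 2) ≤ 0 :=
        mul_nonpos_of_nonneg_of_nonpos (by linarith) (by linarith)
      rw [htb]
      nlinarith
    have h8 : ‖z - (b / ‖y‖) • y‖ = 0 := by
      have := norm_nonneg (z - (b / ‖y‖) • y)
      nlinarith
    exact sub_eq_zero.1 (norm_eq_zero.1 h8)

/-- One step before projection: `θ ↦ θ + α (g(θ, x) + n)`, where `n` is the value of the noise. -/
def preStep {d : ℕ} {X : Type*} (g : Euc d → X → Euc d) (α : ℝ) (θ : Euc d) (x : X)
    (n : Euc d) : Euc d :=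
  θ + α • (g θ x + n)

/-- The iterates `θ_{k+1} = Π_{B(β)}[θ_k + α (g(θ_k, x_k) + ξ_{k+1}(θ_k))]` started at the random
vector `θ₀`. The noise fields are `ξ 1, ξ 2, …`, and `ξ k θ ω` is `ξ_k(θ)` at the outcome `ω`. -/
def saIterate {d : ℕ} {X Ω : Type*} (g : Euc d → X → Euc d) (α : ℝ) (β : ℝ≥0∞)
    (x : ℕ → Ω → X) (ξ : ℕ → Euc d → Ω → Euc d) (θ₀ : Ω → Euc d) : ℕ → Ω → Euc d
  | 0 => θ₀
  | k + 1 => fun ω =>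
      let θ := saIterate g α β x ξ θ₀ k ω
      projBall β (preStep g α θ (x k ω) (ξ (k + 1) θ ω))

/-- The pre-projection iterates `θ_{k+1/2} = θ_k + α (g(θ_k, x_k) + ξ_{k+1}(θ_k))`. -/
def saHalfIterate {d : ℕ} {X Ω : Type*} (g : Euc d → X → Euc d) (α : ℝ) (β : ℝ≥0∞)
    (x : ℕ → Ω → X) (ξ : ℕ → Euc d → Ω → Euc d) (θ₀ : Ω → Euc d) (k : ℕ) (ω : Ω) : Euc d :=
  let θ := saIterate g α β x ξ θ₀ k ω
  preStep g α θ (x k ω) (ξ (k + 1) θ ω)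

/-! ### Histories, the driving chain and the noise -/

/-- The random field `η`, seen as a random element of the space of maps `ℝ^d → ℝ^d`
with the product σ-algebra. -/
def fieldMap {d : ℕ} {Ω : Type*} (η : Euc d → Ω → Euc d) : Ω → (Euc d → Euc d) :=
  fun ω θ => η θ ω

/-- The σ-algebra generated by the random field `η`, i.e. by all the `η θ`. -/
@[reducible] def fieldSigma {d : ℕ} {Ω : Type*} (η : Euc d → Ω → Euc d) : MeasurableSpace Ω :=
  MeasurableSpace.comap (fieldMap η) inferInstance

/-- The σ-algebra `F_k` generated by `x_t, θ_t, ξ_{t+1}` for `t < k` and by `x_k, θ_k`. -/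
@[reducible] def history {d : ℕ} {X Ω : Type*} [MeasurableSpace X]
    (x : ℕ → Ω → X) (θ : ℕ → Ω → Euc d) (ξ : ℕ → Euc d → Ω → Euc d) (k : ℕ) :
    MeasurableSpace Ω :=
  (⨆ t : Fin k, (MeasurableSpace.comap (x t) inferInstance
      ⊔ MeasurableSpace.comap (θ t) inferInstance ⊔ fieldSigma (ξ (t + 1))))
    ⊔ (MeasurableSpace.comap (x k) inferInstance ⊔ MeasurableSpace.comap (θ k) inferInstance)

/-- `(x_k)` is a Markov chain with transition kernel `P` with respect to the σ-algebras `F_k`: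
`P(x_{k+1} ∈ B | F_k) = P(x_k, B)` almost surely. The initial law is arbitrary. -/
structure IsMarkovChain {X Ω : Type*} [MeasurableSpace X] [MeasurableSpace Ω] (ν : Measure Ω)
    (P : Kernel X X) (F : ℕ → MeasurableSpace Ω) (x : ℕ → Ω → X) : Prop where
  measurable : ∀ k, Measurable (x k)
  markov : ∀ (k : ℕ) (B : Set X), MeasurableSet B →
    ν[(x (k + 1) ⁻¹' B).indicator (fun _ => (1 : ℝ)) | F k] =ᵐ[ν] fun ω => (P (x k ω)).real B

/-- The second moment `C(θ) = E[η(θ) ⊗ η(θ)]` of a random field, as the operator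
`v ↦ E[⟨η(θ), v⟩ η(θ)]`. -/
def fieldCov {d : ℕ} {Ω : Type*} [MeasurableSpace Ω] (ν : Measure Ω) (η : Euc d → Ω → Euc d)
    (θ : Euc d) : Euc d →L[ℝ] Euc d :=
  ∫ ω, InnerProductSpace.rankOne ℝ (η θ ω) (η θ ω) ∂ν

/-- The noise assumption of order `2p`: `ξ 1, ξ 2, …` are i.i.d. random fields, `ξ (k+1)` is
independent of the past `F k`, has conditional mean zero, moments of order `2p` with linear growth,
and a twice differentiable second moment whose derivatives grow at most polynomially. -/
structure NoiseAssumption {d : ℕ} {Ω : Type*} [mΩ : MeasurableSpace Ω] (ν : Measure Ω)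
    (F : ℕ → MeasurableSpace Ω) (ξ : ℕ → Euc d → Ω → Euc d) (θstar : Euc d)
    (p : ℕ) (L₂ : ℝ) : Prop where
  L₂_pos : 0 < L₂
  measurable : ∀ k θ, Measurable (ξ (k + 1) θ)
  /-- The field is jointly measurable in the parameter and the outcome, the outcome entering
  only through the field itself (automatic if the field is continuous in the parameter). -/
  jointly_measurable : ∀ k, @Measurable (Euc d × Ω) (Euc d)
    (@Prod.instMeasurableSpace _ _ inferInstance (fieldSigma (ξ (k + 1)))) inferInstance
    (fun q => ξ (k + 1) q.1 q.2)
  indep : iIndepFun (fun k => fieldMap (ξ (k + 1))) ν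
  identDistrib : ∀ k, IdentDistrib (fieldMap (ξ (k + 1))) (fieldMap (ξ 1)) ν ν
  indep_past : ∀ k, Indep (fieldSigma (ξ (k + 1))) (F k) ν
  condExp_eq_zero : ∀ k θ, ν[ξ (k + 1) θ | F k] =ᵐ[ν] 0
  moment_le : ∀ θ, eLpNorm (ξ 1 θ) ((2 * p : ℕ) : ℝ≥0∞) ν
    ≤ ENNReal.ofReal (L₂ * (‖θ - θstar‖ + 1))
  cov_differentiable : Differentiable ℝ (fieldCov ν (ξ 1))
  cov_differentiable_two : Differentiable ℝ (fderiv ℝ (fieldCov ν (ξ 1)))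
  cov_growth : ∃ Mε kε : ℝ, 0 ≤ Mε ∧ 0 ≤ kε ∧ ∀ i : ℕ, 1 ≤ i → i ≤ 2 → ∀ θ,
    ‖iteratedFDeriv ℝ i (fieldCov ν (ξ 1)) θ‖ ≤ Mε * (1 + ‖θ - θstar‖ ^ kε)

end

noncomputable section

/-! Write p = q + 1, K = 1 + ‖θ*‖, L = L₁ + L₂, and measure all errors in L^{2p}. Expanding
‖θ_{k+1/2} - θ*‖^{2p} around θ_k - θ* gives a first-order term and a remainder of second order in
the increment (`norm_add_pow_le`). The first-order term has three parts. The mean field contracts at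
rate αμ by strong monotonicity. The noise has mean zero, because it is independent of the past and
may be evaluated with θ_k frozen. What remains is the Markov error, the pairing of ‖θ_k -
θ*‖^{2q}(θ_k - θ*) with g - ḡ at (θ_k, x_k). It is not centred, since θ_k and x_k are dependent.
Replacing θ_k by θ_{k-τ} costs a Lipschitz constant times the displacement over a mixing time
(`SmoothLinearGrowth.markovError_sub_le`), and then x_k is within α of stationarity given the
history at time k - τ (`IsMarkovChain.integral_prodMk_add_le`).

Let u be the L^{2p} norm of θ_k - θ*. Increments have norm at most αL(u + K), and the displacement
is of order ταL(u + K), so the errors are small against αμu^{2p} once u dominates εK with ε² of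
order ατL²/μ (`drift_bound_le`). This yields a dichotomy (`SAModel.eLpNorm_half_pow_le_max`): above
the threshold εK the 2p-th moment shrinks by 1 - αμ, and below it one step cannot leave the ball of
radius 3εK in L^{2p}. A maximum of two quantities is therefore propagated, so no error terms
accumulate along the iteration. The stationary level (3εK)^{2p} is a constant times (ατ)^p (L²/μ)^p
K^{2p}. The first τ + 1 steps are covered by crude growth bounds. -/

lemma pow_mul_mul_le_sum_pow (q : ℕ) {a b c : ℝ} (ha : 0 ≤ a) (hb : 0 ≤ b) (hc : 0 ≤ c) :
    a ^ (2 * q) * b * c ≤ a ^ (2 * (q + 1)) + b ^ (2 * (q + 1)) + c ^ (2 * (q + 1)) := by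
  set m := max a (max b c) with hm
  have h1 : a ≤ m := le_max_left _ _
  have h2 : b ≤ m := (le_max_left _ _).trans (le_max_right _ _)
  have h3 : c ≤ m := (le_max_right _ _).trans (le_max_right _ _)
  have h0 : 0 ≤ m := ha.trans h1
  have h4 : a ^ (2 * q) * b * c ≤ m ^ (2 * (q + 1)) := by
    calc a ^ (2 * q) * b * c ≤ m ^ (2 * q) * m * m := by gcongr
      _ = m ^ (2 * (q + 1)) := by ring
  have pa := pow_nonneg ha (2 * (q + 1))
  have pb := pow_nonneg hb (2 * (q + 1))
  have pc := pow_nonneg hc (2 * (q + 1))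
  rcases max_choice a (max b c) with h | h
  · rw [← hm] at h; rw [h] at h4; linarith
  · rw [← hm] at h
    rcases max_choice b c with h' | h' <;> rw [h, h'] at h4 <;> linarith

/-! ### Powers of the norm in an inner product space, and the projection -/

section InnerProduct

variable {E : Type*} [NormedAddCommGroup E] [InnerProductSpace ℝ E]

/-- Induction on q: multiply by ‖e + w‖² = ‖e‖² + 2⟨e, w⟩ + ‖w‖². The first-order term is kept
exactly, since drift and noise cancellation both live in it; every other product goes into the
remainder. Its constant obeys (3q + 4)(q + 2) = (3q + 1)(q + 1) + 1 + 4(q + 1) + 2(q + 1). -/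
lemma norm_add_pow_le (q : ℕ) (e w : E) :
    ‖e + w‖ ^ (2 * (q + 1)) ≤ ‖e‖ ^ (2 * (q + 1))
      + 2 * (q + 1) * (‖e‖ ^ (2 * q) * inner ℝ e w)
      + (3 * q + 1) * (q + 1) * ((‖e‖ + ‖w‖) ^ (2 * q) * ‖w‖ * ‖w‖) := by
  have hsq := norm_add_sq_real e w
  have hc := abs_le.1 (abs_real_inner_le_norm e w)
  have hle := norm_add_le e w
  have hx := norm_nonneg e
  have hy := norm_nonneg w
  generalize inner ℝ e w = c at *
  have hn := norm_nonneg (e + w)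
  generalize ‖e + w‖ = z at *
  generalize ‖e‖ = x at *
  generalize ‖w‖ = y at *
  induction q with
  | zero => norm_num; linarith
  | succ q ih =>
    have hc2 : c ^ 2 ≤ x ^ 2 * y ^ 2 := by nlinarith
    have hxs : x ≤ x + y := by linarith
    have hys : y ≤ x + y := by linarith
    have e1 : x ^ (2 * q) * x ^ 2 ≤ (x + y) ^ (2 * q) * (x + y) ^ 2 := by gcongr
    have e2 : x ^ (2 * q) * (c * y ^ 2) ≤ (x + y) ^ (2 * q) * ((x + y) ^ 2 * y ^ 2) := by
      calc x ^ (2 * q) * (c * y ^ 2) ≤ x ^ (2 * q) * ((x * y) * y ^ 2) := by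
            gcongr; exact hc.2
        _ ≤ (x + y) ^ (2 * q) * (((x + y) * (x + y)) * y ^ 2) := by gcongr
        _ = _ := by ring
    have e3 : x ^ (2 * q) * c ^ 2 ≤ (x + y) ^ (2 * q) * ((x + y) ^ 2 * y ^ 2) := by
      calc x ^ (2 * q) * c ^ 2 ≤ x ^ (2 * q) * (x ^ 2 * y ^ 2) := by gcongr
        _ ≤ (x + y) ^ (2 * q) * ((x + y) ^ 2 * y ^ 2) := by gcongr
    have e4 : x ^ (2 * q) * x ^ 2 * y ^ 2 ≤ (x + y) ^ (2 * q) * (x + y) ^ 2 * y ^ 2 := by gcongr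
    have hz2 : z ^ 2 ≤ (x + y) ^ 2 := by gcongr
    have e5 : z ^ 2 * ((3 * q + 1) * (q + 1) * ((x + y) ^ (2 * q) * y * y))
        ≤ (x + y) ^ 2 * ((3 * q + 1) * (q + 1) * ((x + y) ^ (2 * q) * y * y)) := by gcongr
    have e6 := mul_le_mul_of_nonneg_left ih (sq_nonneg z)
    have hq : (0 : ℝ) ≤ q := q.cast_nonneg
    have e2' := mul_le_mul_of_nonneg_left e2 (by positivity : (0 : ℝ) ≤ 2 * (q + 1))
    have e3' := mul_le_mul_of_nonneg_left e3 (by positivity : (0 : ℝ) ≤ 4 * (q + 1))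
    have e7 : z ^ 2 * (x ^ (2 * (q + 1)) + 2 * (q + 1) * (x ^ (2 * q) * c))
        = x ^ (2 * (q + 2)) + 2 * (q + 2) * (x ^ (2 * (q + 1)) * c) + x ^ (2 * q) * x ^ 2 * y ^ 2
          + 4 * (q + 1) * (x ^ (2 * q) * c ^ 2) + 2 * (q + 1) * (x ^ (2 * q) * (c * y ^ 2)) := by
      rw [hsq]; ring
    have e8 : z ^ (2 * (q + 1 + 1)) = z ^ 2 * z ^ (2 * (q + 1)) := by ring
    rw [e8]
    push_cast
    have e9 : (3 * ((q : ℝ) + 1) + 1) * (q + 1 + 1) * ((x + y) ^ (2 * (q + 1)) * y * y)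
        = (x + y) ^ 2 * ((3 * q + 1) * (q + 1) * ((x + y) ^ (2 * q) * y * y))
          + (x + y) ^ (2 * q) * (x + y) ^ 2 * y ^ 2
          + 4 * (q + 1) * ((x + y) ^ (2 * q) * ((x + y) ^ 2 * y ^ 2))
          + 2 * (q + 1) * ((x + y) ^ (2 * q) * ((x + y) ^ 2 * y ^ 2)) := by ring
    rw [e9]
    have e10 : x ^ (2 * (q + 1 + 1)) = x ^ (2 * (q + 2)) := rfl
    rw [e10]
    linarith

/-- Local Lipschitz bound for the gradient direction of ‖·‖^{2q+2}: vary the vector at fixed weight,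
then the weight, whose change is controlled by the mean value bound for t ↦ t^{2q}. -/
lemma norm_pow_smul_sub_le (q : ℕ) (a b : E) :
    ‖(‖a‖ ^ (2 * q)) • a - (‖b‖ ^ (2 * q)) • b‖
      ≤ (2 * q + 1) * ((‖a‖ + ‖b‖) ^ (2 * q) * ‖a - b‖) := by
  have e : (‖a‖ ^ (2 * q)) • a - (‖b‖ ^ (2 * q)) • b
      = (‖a‖ ^ (2 * q)) • (a - b) + (‖a‖ ^ (2 * q) - ‖b‖ ^ (2 * q)) • b := by
    rw [smul_sub, sub_smul]; abel
  have h1 : ‖a‖ ^ (2 * q) * ‖a - b‖ ≤ (‖a‖ + ‖b‖) ^ (2 * q) * ‖a - b‖ := by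
    gcongr; linarith [norm_nonneg b]
  have h2 : |‖a‖ ^ (2 * q) - ‖b‖ ^ (2 * q)| * ‖b‖
      ≤ 2 * q * ((‖a‖ + ‖b‖) ^ (2 * q) * ‖a - b‖) := by
    rcases Nat.eq_zero_or_pos q with rfl | hq
    · simp
    have h3 := abs_pow_sub_pow_le ‖a‖ ‖b‖ (2 * q)
    have h4 : max |‖a‖| |‖b‖| ≤ ‖a‖ + ‖b‖ := by
      simp only [abs_norm]
      exact max_le (by linarith [norm_nonneg b]) (by linarith [norm_nonneg a])
    have h5 : (‖a‖ + ‖b‖) ^ (2 * q) = (‖a‖ + ‖b‖) ^ (2 * q - 1) * (‖a‖ + ‖b‖) := by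
      rw [← pow_succ]; congr 1; omega
    calc |‖a‖ ^ (2 * q) - ‖b‖ ^ (2 * q)| * ‖b‖
        ≤ (|‖a‖ - ‖b‖| * (2 * q : ℕ) * max |‖a‖| |‖b‖| ^ (2 * q - 1)) * ‖b‖ := by gcongr
      _ ≤ (‖a - b‖ * (2 * q : ℕ) * (‖a‖ + ‖b‖) ^ (2 * q - 1)) * (‖a‖ + ‖b‖) := by
          gcongr
          · exact abs_norm_sub_norm_le a b
          · linarith [norm_nonneg a]
      _ = _ := by rw [h5]; push_cast; ring
  rw [e]
  refine (norm_add_le _ _).trans ?_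
  rw [norm_smul, norm_smul, norm_pow, norm_norm, Real.norm_eq_abs]
  linarith

lemma norm_smul_div_sub_le {b : ℝ} (hb : 0 ≤ b) {y z : E} (hy : b < ‖y‖) (hz : ‖z‖ ≤ b) :
    ‖(b / ‖y‖) • y - z‖ ≤ ‖y - z‖ := by
  have hy0 : 0 < ‖y‖ := hb.trans_lt hy
  refine le_of_sq_le_sq ?_ (norm_nonneg _)
  rw [norm_sub_sq_real, norm_sub_sq_real, norm_smul, inner_smul_left,
    Real.norm_of_nonneg (by positivity)]
  have h1 : b / ‖y‖ ≤ 1 := by rw [div_le_one hy0]; exact hy.le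
  have h2 : b / ‖y‖ * ‖y‖ = b := by field_simp
  have h3 := real_inner_le_norm y z
  have h4 : inner ℝ y z ≤ ‖y‖ * b := h3.trans (by gcongr)
  have h5 : (1 - b / ‖y‖) * inner ℝ y z ≤ (1 - b / ‖y‖) * (‖y‖ * b) :=
    mul_le_mul_of_nonneg_left h4 (by linarith)
  have h6 : (1 - b / ‖y‖) * (‖y‖ * b) = ‖y‖ * b - b * b := by
    rw [sub_mul, ← mul_assoc (b / ‖y‖), h2]; ring
  simp only [conj_trivial]
  rw [h2]
  nlinarith [sq_nonneg (‖y‖ - b)]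

end InnerProduct

/-- Projecting never increases the distance to a point of the ball. It serves with two such points:
θ*, so that projection does not hurt the error, and the current iterate, so that it does not enlarge
the increment. -/
lemma norm_projBall_sub_le {d : ℕ} {β : ℝ≥0∞} (y : Euc d) {z : Euc d} (hz : ‖z‖ₑ ≤ β) :
    ‖projBall β y - z‖ ≤ ‖y - z‖ := by
  unfold projBall
  split_ifs with h
  · exact le_rfl
  · push Not at h
    have hβ : β ≠ ∞ := h.ne_top
    have hzr : ‖z‖ ≤ β.toReal := by
      rw [← ofReal_norm] at hz; exact (ENNReal.ofReal_le_iff_le_toReal hβ).1 hz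
    have hyr : β.toReal < ‖y‖ := by
      rw [← ofReal_norm] at h; exact (ENNReal.lt_ofReal_iff_toReal_lt hβ).1 h
    exact norm_smul_div_sub_le ENNReal.toReal_nonneg hyr hzr

lemma measurable_projBall {d : ℕ} (β : ℝ≥0∞) : Measurable (projBall β : Euc d → Euc d) := by
  unfold projBall
  refine Measurable.ite ?_ measurable_id ?_
  · exact measurableSet_le measurable_enorm measurable_const
  · exact (measurable_const.div measurable_norm).smul measurable_id

/-! ### Moments of order `2 (q + 1)` -/

section Moments

variable {Ω : Type*} [MeasurableSpace Ω] {ν : Measure Ω}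

lemma lintegral_enorm_pow_eq {E : Type*} [NormedAddCommGroup E] (f : Ω → E) (q : ℕ) :
    ∫⁻ ω, ‖f ω‖ₑ ^ (2 * (q + 1)) ∂ν = eLpNorm f ((2 * (q + 1) : ℕ) : ℝ≥0∞) ν ^ (2 * (q + 1)) := by
  have h := eLpNorm_nnreal_pow_eq_lintegral (μ := ν) (f := f) (p := ((2 * (q + 1) : ℕ) : ℝ≥0))
    (by positivity)
  have e : (((2 * (q + 1) : ℕ) : ℝ≥0) : ℝ) = ((2 * (q + 1) : ℕ) : ℝ) := by norm_cast
  rw [e] at h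
  simp only [ENNReal.rpow_natCast] at h
  rw [← h]; norm_cast

lemma integrable_pow_of_memLp {f : Ω → ℝ} {q : ℕ}
    (hf : MemLp f ((2 * (q + 1) : ℕ) : ℝ≥0∞) ν) : Integrable (fun ω => f ω ^ (2 * (q + 1))) ν := by
  have h := hf.integrable_norm_pow (by omega)
  refine h.congr (Filter.Eventually.of_forall fun ω => ?_)
  simp only [Real.norm_eq_abs]
  rw [pow_mul, sq_abs, ← pow_mul]

lemma integral_norm_pow_le {E : Type*} [NormedAddCommGroup E] {f : Ω → E} {q : ℕ} {a : ℝ}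
    (hf : AEStronglyMeasurable f ν) (ha : 0 ≤ a)
    (h : eLpNorm f ((2 * (q + 1) : ℕ) : ℝ≥0∞) ν ≤ ENNReal.ofReal a) :
    ∫ ω, ‖f ω‖ ^ (2 * (q + 1)) ∂ν ≤ a ^ (2 * (q + 1)) := by
  rw [integral_eq_lintegral_of_nonneg_ae (f := fun ω => ‖f ω‖ ^ (2 * (q + 1)))
    (Filter.Eventually.of_forall fun ω => by positivity) (hf.norm.pow _)]
  refine ENNReal.toReal_le_of_le_ofReal (by positivity) ?_
  rw [ENNReal.ofReal_pow ha]
  refine le_trans (le_of_eq ?_) (pow_le_pow_left' h _)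
  rw [← lintegral_enorm_pow_eq]
  refine lintegral_congr fun ω => ?_
  rw [ENNReal.ofReal_pow (norm_nonneg _), ofReal_norm]

lemma eLpNorm_pow_eq_ofReal_integral {E : Type*} [NormedAddCommGroup E] {f : Ω → E} {q : ℕ}
    (hf : MemLp f ((2 * (q + 1) : ℕ) : ℝ≥0∞) ν) :
    eLpNorm f ((2 * (q + 1) : ℕ) : ℝ≥0∞) ν ^ (2 * (q + 1))
      = ENNReal.ofReal (∫ ω, ‖f ω‖ ^ (2 * (q + 1)) ∂ν) := by
  rw [← lintegral_enorm_pow_eq, ofReal_integral_eq_lintegral_ofReal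
    (hf.integrable_norm_pow (by omega)) (Filter.Eventually.of_forall fun ω => by positivity)]
  refine lintegral_congr fun ω => ?_
  rw [ENNReal.ofReal_pow (norm_nonneg _), ofReal_norm]

/-- A weak form of Hölder's inequality with exponents `2(q+1)/(2q)`, `2(q+1)` and `2(q+1)`. -/
lemma integrable_and_integral_pow_mul_mul_le {f g h : Ω → ℝ} {q : ℕ} {a b c : ℝ}
    (ha : 0 < a) (hb : 0 < b) (hc : 0 < c)
    (hf : AEStronglyMeasurable f ν) (hg : AEStronglyMeasurable g ν)
    (hh : AEStronglyMeasurable h ν)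
    (f0 : ∀ ω, 0 ≤ f ω) (g0 : ∀ ω, 0 ≤ g ω) (h0 : ∀ ω, 0 ≤ h ω)
    (hfa : eLpNorm f ((2 * (q + 1) : ℕ) : ℝ≥0∞) ν ≤ ENNReal.ofReal a)
    (hgb : eLpNorm g ((2 * (q + 1) : ℕ) : ℝ≥0∞) ν ≤ ENNReal.ofReal b)
    (hhc : eLpNorm h ((2 * (q + 1) : ℕ) : ℝ≥0∞) ν ≤ ENNReal.ofReal c) :
    Integrable (fun ω => f ω ^ (2 * q) * g ω * h ω) ν ∧
      ∫ ω, f ω ^ (2 * q) * g ω * h ω ∂ν ≤ 3 * (a ^ (2 * q) * b * c) := by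
  -- After division by its norm bound each factor has 2(q+1)-th moment at most 1, and the pointwise
  -- Young-type bound `pow_mul_mul_le_sum_pow` sums three of these; hence the factor 3.
  have key : ∀ {k : Ω → ℝ} {t : ℝ}, 0 < t → AEStronglyMeasurable k ν → (∀ ω, 0 ≤ k ω) →
      eLpNorm k ((2 * (q + 1) : ℕ) : ℝ≥0∞) ν ≤ ENNReal.ofReal t →
      Integrable (fun ω => (k ω / t) ^ (2 * (q + 1))) ν ∧
        ∫ ω, (k ω / t) ^ (2 * (q + 1)) ∂ν ≤ 1 := by
    intro k t ht hk k0 hkt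
    have hm : MemLp k ((2 * (q + 1) : ℕ) : ℝ≥0∞) ν := ⟨hk, hkt.trans_lt ENNReal.ofReal_lt_top⟩
    have h1 := integrable_pow_of_memLp hm
    have h2 := integral_norm_pow_le hk ht.le hkt
    simp only [div_pow]
    refine ⟨h1.div_const _, ?_⟩
    rw [integral_div, div_le_one (by positivity)]
    refine le_trans (le_of_eq ?_) h2
    refine integral_congr_ae (Filter.Eventually.of_forall fun ω => ?_)
    simp only [Real.norm_of_nonneg (k0 ω)]
  obtain ⟨if1, if2⟩ := key ha hf f0 hfa
  obtain ⟨ig1, ig2⟩ := key hb hg g0 hgb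
  obtain ⟨ih1, ih2⟩ := key hc hh h0 hhc
  have hsum := (if1.add ig1).add ih1
  have hpt : ∀ ω, f ω ^ (2 * q) * g ω * h ω ≤ (a ^ (2 * q) * b * c) *
      ((f ω / a) ^ (2 * (q + 1)) + (g ω / b) ^ (2 * (q + 1)) + (h ω / c) ^ (2 * (q + 1))) := by
    intro ω
    have := pow_mul_mul_le_sum_pow q (div_nonneg (f0 ω) ha.le) (div_nonneg (g0 ω) hb.le)
      (div_nonneg (h0 ω) hc.le)
    refine le_trans (le_of_eq ?_) (mul_le_mul_of_nonneg_left this (by positivity))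
    rw [div_pow]; field_simp
  have hint : Integrable (fun ω => f ω ^ (2 * q) * g ω * h ω) ν := by
    refine (hsum.const_mul (a ^ (2 * q) * b * c)).mono' (((hf.pow _).mul hg).mul hh)
      (Filter.Eventually.of_forall fun ω => ?_)
    rw [Real.norm_of_nonneg (mul_nonneg (mul_nonneg (pow_nonneg (f0 ω) _) (g0 ω)) (h0 ω))]
    exact hpt ω
  refine ⟨hint, ?_⟩
  refine (integral_mono hint (hsum.const_mul (a ^ (2 * q) * b * c)) hpt).trans ?_
  rw [integral_const_mul, integral_add' (if1.add ig1) ih1, integral_add' if1 ig1]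
  have : 0 < a ^ (2 * q) * b * c := by positivity
  nlinarith

end Moments

/-! ### Total variation -/

section TV

variable {X : Type*} [MeasurableSpace X] {ρ π : Measure X} [IsProbabilityMeasure ρ]
  [IsProbabilityMeasure π]

lemma abs_real_sub_le_tvDist {A : Set X} (hA : MeasurableSet A) :
    |ρ.real A - π.real A| ≤ tvDist ρ π := by
  refine le_ciSup (f := fun A : {A : Set X // MeasurableSet A} => |ρ.real A - π.real A|) ?_ ⟨A, hA⟩
  refine ⟨1, ?_⟩
  rintro _ ⟨B, rfl⟩
  have h1 := measureReal_le_one (μ := ρ) (s := (B : Set X))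
  have h2 := measureReal_le_one (μ := π) (s := (B : Set X))
  have h3 : 0 ≤ ρ.real (B : Set X) := measureReal_nonneg
  have h4 : 0 ≤ π.real (B : Set X) := measureReal_nonneg
  simp only [abs_le]
  constructor <;> linarith

/-- Layer cake: f + B takes values in [0, 2B], so the difference of integrals is the integral over
(0, 2B] of differences of tail probabilities, each at most the total variation distance. -/
lemma abs_integral_sub_le_tvDist {f : X → ℝ} (hf : Measurable f) {B : ℝ} (hB : ∀ x, |f x| ≤ B) :
    |∫ x, f x ∂ρ - ∫ x, f x ∂π| ≤ 2 * B * tvDist ρ π := by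
  have hB0 : 0 ≤ B := by
    obtain ⟨x⟩ : Nonempty X := nonempty_of_isProbabilityMeasure ρ
    exact (abs_nonneg _).trans (hB x)
  have hint : ∀ (σ : Measure X) [IsProbabilityMeasure σ], Integrable f σ := fun σ _ =>
    (integrable_const B).mono' hf.aestronglyMeasurable (Filter.Eventually.of_forall hB)
  have hlc : ∀ (σ : Measure X) [IsProbabilityMeasure σ],
      ∫ x, f x ∂σ + B = ∫ t in Set.Ioc 0 (2 * B), σ.real {a | t ≤ f a + B} := by
    intro σ _
    have h := Integrable.integral_eq_integral_Ioc_meas_le (μ := σ) (f := fun x => f x + B)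
      (M := 2 * B) ((hint σ).add (integrable_const B))
      (Filter.Eventually.of_forall fun x => by
        have := (abs_le.1 (hB x)).1; simp only [Pi.zero_apply]; linarith)
      (Filter.Eventually.of_forall fun x => by
        have := (abs_le.1 (hB x)).2; simp only; linarith)
    rw [← h, integral_add (hint σ) (integrable_const B)]
    simp
  have hii : ∀ (σ : Measure X) [IsProbabilityMeasure σ],
      IntegrableOn (fun t => σ.real {a | t ≤ f a + B}) (Set.Ioc 0 (2 * B)) volume := by
    intro σ _
    have hanti : Antitone fun t => σ.real {a | t ≤ f a + B} := fun s t hst =>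
      measureReal_mono (fun a (ha : t ≤ f a + B) => hst.trans ha)
    refine Measure.integrableOn_of_bounded (M := 1) measure_Ioc_lt_top.ne hanti.measurable.aestronglyMeasurable
      (Filter.Eventually.of_forall fun t => ?_)
    rw [Real.norm_of_nonneg measureReal_nonneg]
    exact measureReal_le_one
  have e : ∫ x, f x ∂ρ - ∫ x, f x ∂π
      = ∫ t in Set.Ioc 0 (2 * B), (ρ.real {a | t ≤ f a + B} - π.real {a | t ≤ f a + B}) := by
    rw [integral_sub (hii ρ) (hii π), ← hlc ρ, ← hlc π]; ring
  rw [e, ← Real.norm_eq_abs]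
  refine (norm_setIntegral_le_of_norm_le_const (C := tvDist ρ π) measure_Ioc_lt_top fun t _ => ?_).trans ?_
  · exact abs_real_sub_le_tvDist (measurableSet_le measurable_const (hf.add_const B))
  · rw [Real.volume_real_Ioc_of_le (by linarith)]
    linarith [mul_comm (tvDist ρ π) (2 * B - 0)]

end TV

/-- Geometric decay makes the defining set nonempty, so `sInf` is an attained minimum and not the
default value 0. -/
lemma one_le_mixingTime_and_tvDist_le {X : Type*} [MeasurableSpace X] {P : Kernel X X}
    {π : Measure X} {r R α : ℝ} (h : UniformlyErgodic P π r R) (hα : 0 < α) :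
    1 ≤ mixingTime P π α ∧ ∀ x, tvDist ((P ^ mixingTime P π α) x) π ≤ α := by
  have hne : {k : ℕ | 1 ≤ k ∧ ∀ x : X, tvDist ((P ^ k) x) π ≤ α}.Nonempty := by
    have h1 : Filter.Tendsto (fun k : ℕ => R * r ^ k) Filter.atTop (nhds (R * 0)) :=
      (tendsto_pow_atTop_nhds_zero_of_lt_one h.r_nonneg h.r_lt_one).const_mul R
    rw [mul_zero] at h1
    obtain ⟨k, hk, hk1⟩ := ((h1.eventually_le_const hα).and (Filter.eventually_ge_atTop 1)).exists
    exact ⟨k, hk1, fun x => (h.tv_le k x).trans hk⟩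
  exact Nat.sInf_mem hne

/-! ### Substituting a past-measurable variable into an independent field -/

section Independence

variable {Ω Ω' E : Type*} [MeasurableSpace Ω] [MeasurableSpace Ω'] [MeasurableSpace E]
  {ν : Measure Ω} [IsProbabilityMeasure ν] {Y : Ω → E} {Z : Ω → Ω'}

/-- Freezing by Fubini: the joint law is a product, so Y may be held fixed while Z is averaged. In
the application Z is the identity of Ω, with the σ-algebra of the noise field on its target. -/
lemma lintegral_prodMk_of_indepFun (hY : Measurable Y) (hZ : Measurable Z)
    (h : IndepFun Y Z ν) {Φ : E × Ω' → ℝ≥0∞} (hΦ : Measurable Φ) :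
    ∫⁻ ω, Φ (Y ω, Z ω) ∂ν = ∫⁻ ω, ∫⁻ ω', Φ (Y ω, Z ω') ∂ν ∂ν := by
  rw [← lintegral_map (f := Φ) (g := fun ω => (Y ω, Z ω)) hΦ (hY.prodMk hZ),
    (indepFun_iff_map_prod_eq_prod_map_map hY.aemeasurable hZ.aemeasurable).1 h,
    lintegral_prod _ hΦ.aemeasurable, lintegral_map hΦ.lintegral_prod_right' hY]
  refine lintegral_congr fun ω => ?_
  exact lintegral_map (hΦ.comp measurable_prodMk_left) hZ

lemma integral_prodMk_of_indepFun (hY : Measurable Y) (hZ : Measurable Z)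
    (h : IndepFun Y Z ν) {Φ : E × Ω' → ℝ} (hΦ : Measurable Φ)
    (hint : Integrable (fun ω => Φ (Y ω, Z ω)) ν) :
    ∫ ω, Φ (Y ω, Z ω) ∂ν = ∫ ω, ∫ ω', Φ (Y ω, Z ω') ∂ν ∂ν := by
  have hYZ : Measurable fun ω => (Y ω, Z ω) := hY.prodMk hZ
  have hlaw := (indepFun_iff_map_prod_eq_prod_map_map hY.aemeasurable hZ.aemeasurable).1 h
  have hint' : Integrable Φ ((ν.map Y).prod (ν.map Z)) := by
    rw [← hlaw]
    exact (integrable_map_measure hΦ.aestronglyMeasurable hYZ.aemeasurable).2 hint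
  rw [← integral_map (f := Φ) (φ := fun ω => (Y ω, Z ω)) hYZ.aemeasurable hΦ.aestronglyMeasurable,
    hlaw, integral_prod _ hint', integral_map hY.aemeasurable]
  · refine integral_congr_ae (Filter.Eventually.of_forall fun ω => ?_)
    simp only
    exact integral_map hZ.aemeasurable
      (hΦ.comp measurable_prodMk_left).aestronglyMeasurable
  · exact hΦ.stronglyMeasurable.integral_prod_right'.aestronglyMeasurable

end Independence

/-! ### Histories -/

section History

variable {d : ℕ} {X Ω : Type*} [MeasurableSpace X] 
  {x : ℕ → Ω → X} {θ : ℕ → Ω → Euc d} {ξ : ℕ → Euc d → Ω → Euc d}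

lemma fieldSigma_le [mΩ : MeasurableSpace Ω] {η : Euc d → Ω → Euc d} (h : ∀ θ, Measurable (η θ)) : fieldSigma η ≤ mΩ :=
  (measurable_pi_iff.2 h : Measurable (fieldMap η)).comap_le

lemma history_le [mΩ : MeasurableSpace Ω] (hx : ∀ k, Measurable (x k)) (hθ : ∀ k, Measurable (θ k))
    (hξ : ∀ k θ, Measurable (ξ (k + 1) θ)) (k : ℕ) : history x θ ξ k ≤ mΩ :=
  sup_le (iSup_le fun _ => sup_le (sup_le (hx _).comap_le (hθ _).comap_le) (fieldSigma_le (hξ _)))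
    (sup_le (hx _).comap_le (hθ _).comap_le)

lemma history_mono : Monotone (history x θ ξ) := by
  intro n k hnk
  have aux : ∀ t, t < k → MeasurableSpace.comap (x t) inferInstance
      ⊔ MeasurableSpace.comap (θ t) inferInstance ⊔ fieldSigma (ξ (t + 1)) ≤ history x θ ξ k :=
    fun t ht => le_sup_of_le_left (le_iSup (fun t : Fin k =>
      MeasurableSpace.comap (x t) inferInstance
        ⊔ MeasurableSpace.comap (θ t) inferInstance ⊔ fieldSigma (ξ (t + 1))) ⟨t, ht⟩)
  refine sup_le (iSup_le fun t => aux t (t.2.trans_le hnk)) ?_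
  rcases hnk.eq_or_lt with rfl | h
  · exact le_sup_right
  · exact le_sup_left.trans (aux n h)

lemma measurable_history_state (k : ℕ) : Measurable[history x θ ξ k] (x k) :=
  Measurable.mono (comap_measurable (x k)) (le_sup_of_le_right le_sup_left) le_rfl

lemma measurable_history_iterate (k : ℕ) : Measurable[history x θ ξ k] (θ k) :=
  Measurable.mono (comap_measurable (θ k)) (le_sup_of_le_right le_sup_right) le_rfl

end History

/-! ### The Markov property for functions of the past and a future state -/

section Markov

variable {X Ω E : Type*} [MeasurableSpace X] [mΩ : MeasurableSpace Ω] [MeasurableSpace E]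
  {ν : Measure Ω} [IsProbabilityMeasure ν] {P : Kernel X X} [IsMarkovKernel P]
  {F : ℕ → MeasurableSpace Ω} {x : ℕ → Ω → X}

instance isMarkovKernel_pow (j : ℕ) : IsMarkovKernel (P ^ j) := by
  induction j with
  | zero => rw [pow_zero]; exact inferInstanceAs (IsMarkovKernel Kernel.id)
  | succ j ih => rw [pow_succ]; exact inferInstanceAs (IsMarkovKernel ((P ^ j) ∘ₖ P))

/-- Two finite measures on a product agree if they agree on rectangles A × B. There the claim is the
Markov property for B, integrated over the F_k-event Z⁻¹(A). The kernel sees x_k only through Z, as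
`hκ` permits. -/
lemma IsMarkovChain.map_prodMk_succ (h : IsMarkovChain ν P F x) {k : ℕ} (hF : F k ≤ mΩ)
    {Z : Ω → E} (hZ : Measurable[F k] Z) {κ : Kernel E X} [IsMarkovKernel κ]
    (hκ : ∀ ω, κ (Z ω) = P (x k ω)) :
    ν.map (fun ω => (Z ω, x (k + 1) ω)) = (ν.map Z) ⊗ₘ κ := by
  have hZ' : Measurable Z := hZ.mono hF le_rfl
  have hx := h.measurable (k + 1)
  have : IsProbabilityMeasure (ν.map Z) := Measure.isProbabilityMeasure_map hZ'.aemeasurable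
  have : IsProbabilityMeasure (ν.map fun ω => (Z ω, x (k + 1) ω)) :=
    Measure.isProbabilityMeasure_map (hZ'.prodMk hx).aemeasurable
  refine Measure.ext_prod fun {A B} hA hB => ?_
  rw [Measure.map_apply (hZ'.prodMk hx) (hA.prod hB), Measure.compProd_apply_prod hA hB,
    setLIntegral_map hA (κ.measurable_coe hB) hZ']
  simp only [hκ]
  have hA' : MeasurableSet[F k] (Z ⁻¹' A) := hZ hA
  have hB' : MeasurableSet (x (k + 1) ⁻¹' B) := hx hB
  have e1 : ∫ ω in Z ⁻¹' A, (P (x k ω)).real B ∂ν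
      = ∫ ω in Z ⁻¹' A, (x (k + 1) ⁻¹' B).indicator (fun _ => (1 : ℝ)) ω ∂ν := by
    have hi : Integrable ((x (k + 1) ⁻¹' B).indicator fun _ => (1 : ℝ)) ν :=
      (integrable_const _).indicator hB'
    rw [← setIntegral_condExp hF hi hA']
    exact integral_congr_ae (ae_restrict_of_ae (h.markov k B hB).symm)
  rw [integral_indicator hB', setIntegral_const, smul_eq_mul, mul_one] at e1
  have e2 : ∫⁻ ω in Z ⁻¹' A, P (x k ω) B ∂ν
      = ENNReal.ofReal (∫ ω in Z ⁻¹' A, (P (x k ω)).real B ∂ν) := by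
    have hm : Measurable fun ω => P (x k ω) B := (P.measurable_coe hB).comp (h.measurable k)
    rw [ofReal_integral_eq_lintegral_ofReal _ (Filter.Eventually.of_forall fun ω =>
      measureReal_nonneg)]
    · refine lintegral_congr fun ω => ?_
      rw [ofReal_measureReal]
    · refine (integrable_const (1 : ℝ)).mono' hm.ennreal_toReal.aestronglyMeasurable
        (Filter.Eventually.of_forall fun ω => ?_)
      rw [Real.norm_of_nonneg measureReal_nonneg]
      exact measureReal_le_one
  rw [e2, e1, measureReal_def, ENNReal.ofReal_toReal (measure_ne_top _ _),
    Measure.restrict_apply hB']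
  congr 1
  ext ω
  simp [and_comm]

/-- Induction on j, peeling off the last transition. Quantifying over all Φ lets the induction
hypothesis be applied to Φ averaged by P in its second argument. -/
lemma IsMarkovChain.lintegral_prodMk_add (h : IsMarkovChain ν P F x) (hF : ∀ k, F k ≤ mΩ)
    (hmono : Monotone F) (hx : ∀ k, Measurable[F k] (x k)) (n j : ℕ)
    {Y : Ω → E} (hY : Measurable[F n] Y) {Φ : E × X → ℝ≥0∞} (hΦ : Measurable Φ) :
    ∫⁻ ω, Φ (Y ω, x (n + j) ω) ∂ν = ∫⁻ ω, ∫⁻ y, Φ (Y ω, y) ∂(P ^ j) (x n ω) ∂ν := by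
  induction j generalizing Φ with
  | zero =>
    refine lintegral_congr fun ω => ?_
    rw [pow_zero]
    change _ = ∫⁻ y, Φ (Y ω, y) ∂(Kernel.id (x n ω))
    rw [Kernel.id_apply, lintegral_dirac' _ (by exact hΦ.comp measurable_prodMk_left), add_zero]
  | succ j ih =>
    have hYj : Measurable[F (n + j)] Y := hY.mono (hmono (Nat.le_add_right n j)) le_rfl
    have hZ : Measurable[F (n + j)] fun ω => (Y ω, x (n + j) ω) := hYj.prodMk (hx (n + j))
    have hZ' : Measurable fun ω => (Y ω, x (n + j) ω) := hZ.mono (hF _) le_rfl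
    have hlaw := h.map_prodMk_succ (hF (n + j)) hZ (κ := Kernel.prodMkLeft E P)
      (fun _ => rfl)
    have hΨ : Measurable fun p : (E × X) × X => Φ (p.1.1, p.2) :=
      hΦ.comp ((measurable_fst.comp measurable_fst).prodMk measurable_snd)
    have hΦ' : Measurable fun p : E × X => ∫⁻ y, Φ (p.1, y) ∂P p.2 :=
      hΨ.lintegral_kernel_prod_right' (κ := Kernel.prodMkLeft E P)
    calc ∫⁻ ω, Φ (Y ω, x (n + (j + 1)) ω) ∂ν
        = ∫⁻ p, Φ (p.1.1, p.2) ∂(ν.map fun ω => ((Y ω, x (n + j) ω), x (n + j + 1) ω)) := by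
          rw [lintegral_map hΨ (hZ'.prodMk (h.measurable _))]; rfl
      _ = ∫⁻ ω, ∫⁻ y, Φ (Y ω, y) ∂P (x (n + j) ω) ∂ν := by
          rw [hlaw, Measure.lintegral_compProd hΨ, lintegral_map _ hZ']
          · rfl
          · exact hΦ'
      _ = _ := by
          rw [ih hΦ']
          refine lintegral_congr fun ω => ?_
          rw [pow_succ']
          change _ = ∫⁻ y, Φ (Y ω, y) ∂(P ∘ₖ (P ^ j)) (x n ω)
          rw [Kernel.lintegral_comp _ _ _ (by exact hΦ.comp measurable_prodMk_left)]

lemma IsMarkovChain.map_prodMk_add (h : IsMarkovChain ν P F x) (hF : ∀ k, F k ≤ mΩ)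
    (hmono : Monotone F) (hx : ∀ k, Measurable[F k] (x k)) (n j : ℕ)
    {Y : Ω → E} (hY : Measurable[F n] Y) :
    ν.map (fun ω => ((Y ω, x n ω), x (n + j) ω))
      = (ν.map fun ω => (Y ω, x n ω)) ⊗ₘ Kernel.prodMkLeft E (P ^ j) := by
  have hZ : Measurable[F n] fun ω => (Y ω, x n ω) := hY.prodMk (hx n)
  have hZ' : Measurable fun ω => (Y ω, x n ω) := hZ.mono (hF _) le_rfl
  have := Measure.isProbabilityMeasure_map (μ := ν) hZ'.aemeasurable
  refine Measure.ext fun s hs => ?_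
  have hΦ : Measurable (s.indicator fun _ => (1 : ℝ≥0∞)) := measurable_const.indicator hs
  rw [← lintegral_indicator_one hs, ← lintegral_indicator_one hs,
    Measure.lintegral_compProd (by exact hΦ)]
  change ∫⁻ p, s.indicator (fun _ => (1 : ℝ≥0∞)) p ∂_ = _
  rw [lintegral_map hΦ (hZ'.prodMk (h.measurable _)),
    lintegral_map (by exact hΦ.lintegral_kernel_prod_right' (κ := Kernel.prodMkLeft E (P ^ j))) hZ',
    h.lintegral_prodMk_add hF hmono hx n j hZ hΦ]
  rfl

/-- Given the history at time n, the state x_{n+j} has law P^j(x_n, ·), which is a-close to π, and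
Φ(e, ·) has π-mean zero; so the conditional mean is at most 2a b(Y). -/
lemma IsMarkovChain.integral_prodMk_add_le (h : IsMarkovChain ν P F x) (hF : ∀ k, F k ≤ mΩ)
    (hmono : Monotone F) (hx : ∀ k, Measurable[F k] (x k)) (n j : ℕ)
    {π : Measure X} [IsProbabilityMeasure π] {a : ℝ} (htv : ∀ x, tvDist ((P ^ j) x) π ≤ a)
    {Y : Ω → E} (hY : Measurable[F n] Y) {Φ : E × X → ℝ} (hΦ : Measurable Φ) {b : E → ℝ}
    (hb : ∀ e y, |Φ (e, y)| ≤ b e) (hbint : Integrable (fun ω => b (Y ω)) ν)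
    (hπ : ∀ e, ∫ y, Φ (e, y) ∂π = 0) :
    Integrable (fun ω => Φ (Y ω, x (n + j) ω)) ν ∧
      ∫ ω, Φ (Y ω, x (n + j) ω) ∂ν ≤ 2 * a * ∫ ω, b (Y ω) ∂ν := by
  have hY' : Measurable Y := hY.mono (hF _) le_rfl
  have hZ' : Measurable fun ω => (Y ω, x n ω) := hY'.prodMk (h.measurable _)
  have hint : Integrable (fun ω => Φ (Y ω, x (n + j) ω)) ν :=
    hbint.mono' (hΦ.comp (hY'.prodMk (h.measurable _))).aestronglyMeasurable
      (Filter.Eventually.of_forall fun ω => hb _ _)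
  refine ⟨hint, ?_⟩
  have hΨ : Measurable fun p : (E × X) × X => Φ (p.1.1, p.2) :=
    hΦ.comp ((measurable_fst.comp measurable_fst).prodMk measurable_snd)
  have hZx : Measurable fun ω => ((Y ω, x n ω), x (n + j) ω) := hZ'.prodMk (h.measurable _)
  have hlaw := h.map_prodMk_add hF hmono hx n j hY
  have := Measure.isProbabilityMeasure_map (μ := ν) hZ'.aemeasurable
  have hint' : Integrable (fun p : (E × X) × X => Φ (p.1.1, p.2))
      ((ν.map fun ω => (Y ω, x n ω)) ⊗ₘ Kernel.prodMkLeft E (P ^ j)) := by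
    rw [← hlaw]
    exact (integrable_map_measure hΨ.aestronglyMeasurable hZx.aemeasurable).2 hint
  have e : ∫ ω, Φ (Y ω, x (n + j) ω) ∂ν = ∫ ω, ∫ y, Φ (Y ω, y) ∂(P ^ j) (x n ω) ∂ν := by
    rw [← integral_map (f := fun p : (E × X) × X => Φ (p.1.1, p.2)) hZx.aemeasurable
      hΨ.aestronglyMeasurable, hlaw, Measure.integral_compProd hint',
      integral_map hZ'.aemeasurable]
    · rfl
    · exact (hΨ.stronglyMeasurable.integral_kernel_prod_right'
        (κ := Kernel.prodMkLeft E (P ^ j))).aestronglyMeasurable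
  rw [e, ← integral_const_mul]
  refine (le_abs_self _).trans ?_
  rw [← Real.norm_eq_abs]
  refine norm_integral_le_of_norm_le (hbint.const_mul _) (Filter.Eventually.of_forall fun ω => ?_)
  have h1 := abs_integral_sub_le_tvDist (ρ := (P ^ j) (x n ω)) (π := π)
    (hΦ.comp measurable_prodMk_left) (hb (Y ω))
  simp only [Function.comp_apply, hπ, sub_zero] at h1
  have hb0 : 0 ≤ b (Y ω) := (abs_nonneg _).trans (hb _ (x n ω))
  rw [Real.norm_eq_abs]
  refine h1.trans ?_
  nlinarith [htv (x n ω)]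

end Markov

/-! ### The update function and its mean -/

section Update

variable {d : ℕ} {X : Type*} {g : Euc d → X → Euc d} {L₁ : ℝ}

lemma SmoothLinearGrowth.norm_sub_le (h : SmoothLinearGrowth g L₁) (x : X) (θ θ' : Euc d) :
    ‖g θ x - g θ' x‖ ≤ L₁ * ‖θ - θ'‖ := by
  have := h.lipschitz_deriv 0 (by norm_num) x θ θ'
  rw [iteratedFDeriv_zero_eq_comp] at this
  simp only [Function.comp_apply] at this
  rwa [← map_sub, LinearIsometryEquiv.norm_map] at this

/-- Linear growth recentred at the target; this is where the constant 1 + ‖θ*‖ enters. -/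
lemma SmoothLinearGrowth.norm_le (h : SmoothLinearGrowth g L₁) (x : X) (θ θstar : Euc d) :
    ‖g θ x‖ ≤ L₁ * (‖θ - θstar‖ + (1 + ‖θstar‖)) := by
  have h1 := h.norm_sub_le x θ 0
  have h2 := h.norm_zero_le x
  have h3 : ‖g θ x‖ ≤ ‖g θ x - g 0 x‖ + ‖g 0 x‖ := by
    simpa using norm_add_le (g θ x - g 0 x) (g 0 x)
  have h4 : ‖θ‖ ≤ ‖θ - θstar‖ + ‖θstar‖ := by simpa using norm_add_le (θ - θstar) θstar
  rw [sub_zero] at h1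
  nlinarith [h.L₁_pos]

variable [MeasurableSpace X]

lemma SmoothLinearGrowth.measurable_uncurry (h : SmoothLinearGrowth g L₁)
    (hg : ∀ θ, Measurable (g θ)) : Measurable (Function.uncurry g) :=
  measurable_uncurry_of_continuous_of_measurable (u := g) (fun x => (h.contDiff x).continuous) hg

variable {π : Measure X} [IsProbabilityMeasure π]

lemma SmoothLinearGrowth.integrable (h : SmoothLinearGrowth g L₁) (hg : ∀ θ, Measurable (g θ))
    (θ : Euc d) : Integrable (g θ) π :=
  (integrable_const _).mono' (hg θ).aestronglyMeasurable
    (Filter.Eventually.of_forall fun x => h.norm_le x θ 0)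

lemma SmoothLinearGrowth.norm_meanUpdate_sub_le (h : SmoothLinearGrowth g L₁)
    (hg : ∀ θ, Measurable (g θ)) (θ θ' : Euc d) :
    ‖meanUpdate g π θ - meanUpdate g π θ'‖ ≤ L₁ * ‖θ - θ'‖ := by
  unfold meanUpdate
  rw [← integral_sub (h.integrable hg θ) (h.integrable hg θ')]
  refine (norm_integral_le_of_norm_le_const (C := L₁ * ‖θ - θ'‖)
    (Filter.Eventually.of_forall fun x => h.norm_sub_le x θ θ')).trans ?_
  simp

lemma SmoothLinearGrowth.norm_meanUpdate_le (h : SmoothLinearGrowth g L₁) (θ θstar : Euc d) :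
    ‖meanUpdate g π θ‖ ≤ L₁ * (‖θ - θstar‖ + (1 + ‖θstar‖)) := by
  refine (norm_integral_le_of_norm_le_const (C := L₁ * (‖θ - θstar‖ + (1 + ‖θstar‖)))
    (Filter.Eventually.of_forall fun x => h.norm_le x θ θstar)).trans ?_
  simp

lemma SmoothLinearGrowth.measurable_meanUpdate (h : SmoothLinearGrowth g L₁)
    (hg : ∀ θ, Measurable (g θ)) : Measurable (meanUpdate g π) :=
  ((h.measurable_uncurry hg).stronglyMeasurable.integral_prod_right).measurable

lemma SmoothLinearGrowth.integral_inner_sub_meanUpdate (h : SmoothLinearGrowth g L₁)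
    (hg : ∀ θ, Measurable (g θ)) (θ v : Euc d) :
    ∫ x, inner ℝ v (g θ x - meanUpdate g π θ) ∂π = 0 := by
  have hi : Integrable (fun x => g θ x - meanUpdate g π θ) π :=
    (h.integrable hg θ).sub (integrable_const _)
  rw [integral_inner hi,
    integral_sub (h.integrable hg θ) (integrable_const _)]
  simp [meanUpdate]

end Update

lemma eLpNorm_mul_norm_add_le {Ω E : Type*} [MeasurableSpace Ω] {ν : Measure Ω}
    [IsProbabilityMeasure ν] [NormedAddCommGroup E] {f : Ω → E} {r : ℝ≥0∞} (hr : 1 ≤ r)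
    {a b c : ℝ} (ha : 0 ≤ a) (hb : 0 ≤ b) (hc : 0 ≤ c) (hf : AEStronglyMeasurable f ν)
    (h : eLpNorm f r ν ≤ ENNReal.ofReal a) :
    eLpNorm (fun ω => c * (‖f ω‖ + b)) r ν ≤ ENNReal.ofReal (c * (a + b)) := by
  have hr0 : r ≠ 0 := (zero_lt_one.trans_le hr).ne'
  have h1 : eLpNorm (fun ω => c * (‖f ω‖ + b)) r ν = ‖c‖ₑ * eLpNorm (fun ω => ‖f ω‖ + b) r ν :=
    eLpNorm_const_smul c (fun ω => ‖f ω‖ + b) r ν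
  rw [h1, ENNReal.ofReal_mul hc, Real.enorm_of_nonneg hc, ENNReal.ofReal_add ha hb]
  gcongr
  refine (eLpNorm_add_le (f := fun ω => ‖f ω‖) (g := fun _ => b) hf.norm
    aestronglyMeasurable_const hr).trans ?_
  rw [eLpNorm_norm, eLpNorm_const _ hr0 (IsProbabilityMeasure.ne_zero ν)]
  gcongr
  simp [Real.enorm_of_nonneg hb]

/-! ### Noise evaluated at the current iterate -/

section Noise

variable {d : ℕ} {Ω : Type*} [mΩ : MeasurableSpace Ω] {ν : Measure Ω}
  {F : ℕ → MeasurableSpace Ω} {ξ : ℕ → Euc d → Ω → Euc d} {θstar : Euc d} {L₂ : ℝ} {q : ℕ}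
  {Y : Ω → Euc d} {k : ℕ}

lemma measurable_comp_prodMk {Ω Ω' E G : Type*} [MeasurableSpace Ω] [MeasurableSpace Ω']
    [MeasurableSpace E] [MeasurableSpace G] {Φ : E × Ω' → G} (hΦ : Measurable Φ) {Y : Ω → E}
    {Z : Ω → Ω'} (hY : Measurable Y) (hZ : Measurable Z) : Measurable fun ω => Φ (Y ω, Z ω) :=
  hΦ.comp (hY.prodMk hZ)

lemma measurable_enorm_pow_comp {Ω' : Type*} [MeasurableSpace Ω'] {Φ : Ω' → Euc d}
    (hΦ : Measurable Φ) (n : ℕ) : Measurable fun a => ‖Φ a‖ₑ ^ n :=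
  hΦ.enorm.pow_const n

lemma measurable_inner_fst {Ω' : Type*} [MeasurableSpace Ω'] {V : Euc d → Euc d}
    (hV : Measurable V) {Φ : Euc d × Ω' → Euc d} (hΦ : Measurable Φ) :
    Measurable fun a => (inner ℝ (V a.1) (Φ a) : ℝ) :=
  (hV.comp measurable_fst).inner hΦ

lemma measurable_field_apply {η : Euc d → Ω → Euc d} (hη : ∀ θ, Measurable (η θ))
    (h : @Measurable (Euc d × Ω) (Euc d)
      (@Prod.instMeasurableSpace _ _ inferInstance (fieldSigma η)) inferInstance
      (fun q => η q.1 q.2)) (hY : Measurable Y) : Measurable fun ω => η (Y ω) ω := by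
  have h1 : @Measurable Ω Ω mΩ (fieldSigma η) id := fun s hs => fieldSigma_le hη s hs
  exact @measurable_comp_prodMk Ω Ω (Euc d) (Euc d) mΩ (fieldSigma η) _ _ _ h _ _ hY h1

/-- The noise field is encoded by the identity map into Ω with the field's own σ-algebra, the one
for which joint measurability is assumed; independence from the past then becomes independence of
two random variables. -/
lemma NoiseAssumption.indepFun_id {p : ℕ} (h : NoiseAssumption ν F ξ θstar p L₂)
    (hY : Measurable[F k] Y) :
    @IndepFun _ _ _ mΩ _ (fieldSigma (ξ (k + 1))) Y id ν := by
  rw [@IndepFun_iff_Indep _ _ _ _ _ (fieldSigma (ξ (k + 1)))]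
  refine indep_of_indep_of_le_left (indep_of_indep_of_le_right (h.indep_past k).symm ?_)
    hY.comap_le
  rw [MeasurableSpace.comap_id]

lemma NoiseAssumption.eLpNorm_eq {p : ℕ} (h : NoiseAssumption ν F ξ θstar p L₂)
    (k : ℕ) (θ : Euc d) (r : ℝ≥0∞) : eLpNorm (ξ (k + 1) θ) r ν = eLpNorm (ξ 1 θ) r ν :=
  ((h.identDistrib k).comp (measurable_pi_apply θ)).eLpNorm_eq r

lemma NoiseAssumption.measurable_id {p : ℕ} (h : NoiseAssumption ν F ξ θstar p L₂) (k : ℕ) :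
    @Measurable Ω Ω mΩ (fieldSigma (ξ (k + 1))) id :=
  fun s hs => fieldSigma_le (h.measurable k) s hs

variable [IsProbabilityMeasure ν]

/-- Freeze the past-measurable argument, use the moment bound at a fixed parameter together with
equality in law of the fields, then apply Minkowski. -/
lemma NoiseAssumption.eLpNorm_apply_le (h : NoiseAssumption ν F ξ θstar (q + 1) L₂)
    (hF : F k ≤ mΩ) (hY : Measurable[F k] Y) {u : ℝ} (hu : 0 ≤ u)
    (hYu : eLpNorm (fun ω => Y ω - θstar) ((2 * (q + 1) : ℕ) : ℝ≥0∞) ν ≤ ENNReal.ofReal u) :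
    eLpNorm (fun ω => ξ (k + 1) (Y ω) ω) ((2 * (q + 1) : ℕ) : ℝ≥0∞) ν
      ≤ ENNReal.ofReal (L₂ * (u + 1)) := by
  have hY' : Measurable Y := hY.mono hF le_rfl
  refine le_trans ?_ (eLpNorm_mul_norm_add_le (by exact_mod_cast (by omega : 1 ≤ 2 * (q + 1))) hu
    zero_le_one h.L₂_pos.le (hY'.sub_const θstar).aestronglyMeasurable hYu)
  refine (ENNReal.pow_le_pow_left_iff (n := 2 * (q + 1)) (by omega)).1 ?_
  rw [← lintegral_enorm_pow_eq, ← lintegral_enorm_pow_eq]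
  have hΦ := @measurable_enorm_pow_comp d (Euc d × Ω)
    (@Prod.instMeasurableSpace _ _ inferInstance (fieldSigma (ξ (k + 1)))) _
    (h.jointly_measurable k) (2 * (q + 1))
  refine (@lintegral_prodMk_of_indepFun Ω Ω (Euc d) mΩ (fieldSigma (ξ (k + 1))) _ ν _ Y id hY'
    (h.measurable_id k) (h.indepFun_id hY) _ hΦ).trans_le ?_
  refine lintegral_mono fun ω => ?_
  simp only [id]
  rw [lintegral_enorm_pow_eq, h.eLpNorm_eq, Real.enorm_of_nonneg
    (mul_nonneg h.L₂_pos.le (add_nonneg (norm_nonneg _) zero_le_one))]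
  exact pow_le_pow_left' (h.moment_le _) _

lemma NoiseAssumption.integral_inner_eq_zero {p : ℕ} (h : NoiseAssumption ν F ξ θstar p L₂)
    (hp : 1 ≤ p) (hF : F k ≤ mΩ) (hY : Measurable[F k] Y) {V : Euc d → Euc d} (hV : Measurable V)
    (hint : Integrable (fun ω => (inner ℝ (V (Y ω)) (ξ (k + 1) (Y ω) ω) : ℝ)) ν) :
    ∫ ω, (inner ℝ (V (Y ω)) (ξ (k + 1) (Y ω) ω) : ℝ) ∂ν = 0 := by
  have hY' : Measurable Y := hY.mono hF le_rfl
  have hΦ : @Measurable (Euc d × Ω) ℝ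
      (@Prod.instMeasurableSpace _ _ inferInstance (fieldSigma (ξ (k + 1)))) _
      (fun a => (inner ℝ (V a.1) (ξ (k + 1) a.1 a.2) : ℝ)) :=
    @measurable_inner_fst d Ω (fieldSigma (ξ (k + 1))) V hV _ (h.jointly_measurable k)
  refine (@integral_prodMk_of_indepFun Ω Ω (Euc d) mΩ (fieldSigma (ξ (k + 1))) _ ν _ Y id hY'
      (h.measurable_id k) (h.indepFun_id hY) _ hΦ hint).trans ?_
  refine integral_eq_zero_of_ae (Filter.Eventually.of_forall fun ω => ?_)
  simp only [id, Pi.zero_apply]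
  have hm : MemLp (ξ (k + 1) (Y ω)) ((2 * p : ℕ) : ℝ≥0∞) ν := by
    refine ⟨(h.measurable k _).aestronglyMeasurable, ?_⟩
    rw [h.eLpNorm_eq]
    exact (h.moment_le _).trans_lt ENNReal.ofReal_lt_top
  have hi : Integrable (ξ (k + 1) (Y ω)) ν :=
    hm.integrable (by exact_mod_cast (by omega : 1 ≤ 2 * p))
  rw [integral_inner hi, ← integral_condExp hF, integral_congr_ae (h.condExp_eq_zero k _)]
  simp

end Noise

/-! ### The iterates -/

section Iterates

variable {d : ℕ} {X Ω : Type*} {g : Euc d → X → Euc d} {α : ℝ} {β : ℝ≥0∞} {x : ℕ → Ω → X} {ξ : ℕ → Euc d → Ω → Euc d}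
  {θ₀ : Ω → Euc d} {L₁ L₂ : ℝ} {θstar : Euc d} {q : ℕ}

lemma saHalfIterate_eq (k : ℕ) (ω : Ω) : saHalfIterate g α β x ξ θ₀ k ω
    = saIterate g α β x ξ θ₀ k ω + α • (g (saIterate g α β x ξ θ₀ k ω) (x k ω)
      + ξ (k + 1) (saIterate g α β x ξ θ₀ k ω) ω) := rfl

lemma enorm_saIterate_succ_le (k : ℕ) (ω : Ω) : ‖saIterate g α β x ξ θ₀ (k + 1) ω‖ₑ ≤ β :=
  projBall_mem β _

lemma norm_saIterate_succ_sub_le (hβ : ‖θstar‖ₑ ≤ β) (k : ℕ) (ω : Ω) :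
    ‖saIterate g α β x ξ θ₀ (k + 1) ω - θstar‖ ≤ ‖saHalfIterate g α β x ξ θ₀ k ω - θstar‖ :=
  norm_projBall_sub_le _ hβ

/-- The restriction to k ≥ 1 matters: θ₀ may lie outside the ball, and then the first projection can
move it arbitrarily far. -/
lemma norm_saIterate_succ_sub_saIterate_le {k : ℕ} (hk : 1 ≤ k) (ω : Ω) :
    ‖saIterate g α β x ξ θ₀ (k + 1) ω - saIterate g α β x ξ θ₀ k ω‖
      ≤ ‖saHalfIterate g α β x ξ θ₀ k ω - saIterate g α β x ξ θ₀ k ω‖ := by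
  obtain ⟨k, rfl⟩ := Nat.exists_eq_add_of_le' hk
  exact norm_projBall_sub_le _ (enorm_saIterate_succ_le k ω)

variable [MeasurableSpace X] [mΩ : MeasurableSpace Ω] {ν : Measure Ω}

lemma measurable_saHalfIterate_of {k : ℕ} {F : ℕ → MeasurableSpace Ω} {p : ℕ}
    (hs : SmoothLinearGrowth g L₁) (hg : ∀ θ, Measurable (g θ)) (hx : ∀ k, Measurable (x k))
    (h : NoiseAssumption ν F ξ θstar p L₂) (hθ : Measurable (saIterate g α β x ξ θ₀ k)) :
    Measurable (saHalfIterate g α β x ξ θ₀ k) :=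
  hθ.add ((((hs.measurable_uncurry hg).comp (hθ.prodMk (hx k))).add
    (measurable_field_apply (h.measurable k) (h.jointly_measurable k) hθ)).const_smul α)

lemma measurable_saIterate {F : ℕ → MeasurableSpace Ω} {p : ℕ}
    (hs : SmoothLinearGrowth g L₁) (hg : ∀ θ, Measurable (g θ)) (hx : ∀ k, Measurable (x k))
    (h : NoiseAssumption ν F ξ θstar p L₂) (h0 : Measurable θ₀) (k : ℕ) :
    Measurable (saIterate g α β x ξ θ₀ k) := by
  induction k with
  | zero => exact h0
  | succ k ih => exact (measurable_projBall β).comp (measurable_saHalfIterate_of hs hg hx h ih)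

variable [IsProbabilityMeasure ν]

/-- The increment of one step before projection, in `L^{2(q+1)}`. -/
lemma eLpNorm_saHalfIterate_sub_le {F : ℕ → MeasurableSpace Ω} {k : ℕ}
    (hs : SmoothLinearGrowth g L₁) (hg : ∀ θ, Measurable (g θ)) (hx : ∀ k, Measurable (x k))
    (h : NoiseAssumption ν F ξ θstar (q + 1) L₂) (hα : 0 ≤ α) (hF : F k ≤ mΩ)
    (hθ : Measurable[F k] (saIterate g α β x ξ θ₀ k)) {u : ℝ} (hu : 0 ≤ u)
    (hU : eLpNorm (fun ω => saIterate g α β x ξ θ₀ k ω - θstar) ((2 * (q + 1) : ℕ) : ℝ≥0∞) ν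
      ≤ ENNReal.ofReal u) :
    eLpNorm (fun ω => saHalfIterate g α β x ξ θ₀ k ω - saIterate g α β x ξ θ₀ k ω)
      ((2 * (q + 1) : ℕ) : ℝ≥0∞) ν
      ≤ ENNReal.ofReal (α * (L₁ + L₂) * (u + (1 + ‖θstar‖))) := by
  have hr : (1 : ℝ≥0∞) ≤ ((2 * (q + 1) : ℕ) : ℝ≥0∞) := by
    exact_mod_cast (by omega : 1 ≤ 2 * (q + 1))
  have hθ' : Measurable (saIterate g α β x ξ θ₀ k) := hθ.mono hF le_rfl
  have mg : Measurable fun ω => g (saIterate g α β x ξ θ₀ k ω) (x k ω) :=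
    (hs.measurable_uncurry hg).comp (hθ'.prodMk (hx k))
  have mξ := measurable_field_apply (h.measurable k) (h.jointly_measurable k) hθ'
  have e : (fun ω => saHalfIterate g α β x ξ θ₀ k ω - saIterate g α β x ξ θ₀ k ω)
      = α • ((fun ω => g (saIterate g α β x ξ θ₀ k ω) (x k ω))
        + fun ω => ξ (k + 1) (saIterate g α β x ξ θ₀ k ω) ω) := by
    funext ω
    simp [saHalfIterate_eq]
  have n1 : eLpNorm (fun ω => g (saIterate g α β x ξ θ₀ k ω) (x k ω))
      ((2 * (q + 1) : ℕ) : ℝ≥0∞) ν ≤ ENNReal.ofReal (L₁ * (u + (1 + ‖θstar‖))) :=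
    (eLpNorm_mono_real fun ω => hs.norm_le _ _ θstar).trans
      (eLpNorm_mul_norm_add_le hr hu (by positivity) hs.L₁_pos.le
        (hθ'.sub_const θstar).aestronglyMeasurable hU)
  have n2 := h.eLpNorm_apply_le hF hθ hu hU
  have n3 : L₂ * (u + 1) ≤ L₂ * (u + (1 + ‖θstar‖)) := by
    have := h.L₂_pos
    gcongr; linarith [norm_nonneg θstar]
  have := hs.L₁_pos
  have := h.L₂_pos
  rw [e, eLpNorm_const_smul, Real.enorm_of_nonneg hα, mul_assoc, ENNReal.ofReal_mul hα, add_mul,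
    ENNReal.ofReal_add (by positivity) (by positivity)]
  gcongr
  refine (eLpNorm_add_le mg.aestronglyMeasurable mξ.aestronglyMeasurable hr).trans ?_
  exact add_le_add n1 (n2.trans (ENNReal.ofReal_le_ofReal n3))

end Iterates

/-! ### The drift inequality -/

section Drift

variable {d : ℕ} {X : Type*} {g : Euc d → X → Euc d} {L₁ : ℝ} {θstar : Euc d}

/-- `⟨‖θ - θ*‖^{2q} (θ - θ*), g(θ, y) - ḡ(θ)⟩`, as a function of `(θ, y)`. -/
def markovError [MeasurableSpace X] (g : Euc d → X → Euc d) (π : Measure X) (θstar : Euc d) (q : ℕ)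
    (a : Euc d × X) : ℝ :=
  inner ℝ ((‖a.1 - θstar‖ ^ (2 * q)) • (a.1 - θstar)) (g a.1 a.2 - meanUpdate g π a.1)

variable [MeasurableSpace X] {π : Measure X} [IsProbabilityMeasure π]

lemma SmoothLinearGrowth.measurable_markovError (hs : SmoothLinearGrowth g L₁)
    (hg : ∀ θ, Measurable (g θ)) (q : ℕ) : Measurable (markovError g π θstar q) := by
  have h1 : Measurable fun a : Euc d × X => a.1 - θstar := measurable_fst.sub_const _
  exact ((h1.norm.pow_const _).smul h1).inner
    ((hs.measurable_uncurry hg).sub ((hs.measurable_meanUpdate hg).comp measurable_fst))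

lemma SmoothLinearGrowth.abs_markovError_le (hs : SmoothLinearGrowth g L₁) (q : ℕ) (θ : Euc d)
    (y : X) : |markovError g π θstar q (θ, y)| ≤ 2 * L₁ *
      (‖θ - θstar‖ ^ (2 * q) * ‖θ - θstar‖ * (‖θ - θstar‖ + (1 + ‖θstar‖))) := by
  refine (abs_real_inner_le_norm _ _).trans ?_
  rw [norm_smul, norm_pow, norm_norm]
  have h1 : ‖g θ y - meanUpdate g π θ‖ ≤ 2 * L₁ * (‖θ - θstar‖ + (1 + ‖θstar‖)) := by
    have := _root_.norm_sub_le (g θ y) (meanUpdate g π θ)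
    have := hs.norm_le y θ θstar
    have := hs.norm_meanUpdate_le (π := π) θ θstar
    linarith
  calc _ ≤ ‖θ - θstar‖ ^ (2 * q) * ‖θ - θstar‖ * (2 * L₁ * (‖θ - θstar‖ + (1 + ‖θstar‖))) := by
        gcongr
    _ = _ := by ring

/-- Product rule for differences: each factor of the inner product is locally Lipschitz and has
controlled growth. -/
lemma SmoothLinearGrowth.markovError_sub_le (hs : SmoothLinearGrowth g L₁)
    (hg : ∀ θ, Measurable (g θ)) (q : ℕ) (θ θ' : Euc d) (y : X) :
    markovError g π θstar q (θ, y) - markovError g π θstar q (θ', y)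
      ≤ 4 * (q + 1) * L₁ * ((‖θ - θstar‖ + ‖θ' - θstar‖) ^ (2 * q) * ‖θ - θ'‖
        * (‖θ - θstar‖ + ‖θ' - θstar‖ + (1 + ‖θstar‖))) := by
  unfold markovError
  simp only
  set e := θ - θstar with he
  set e' := θ' - θstar with he'
  have hδ : e - e' = θ - θ' := by rw [he, he']; abel
  set K := 1 + ‖θstar‖ with hK
  have hK0 : 0 < K := by positivity
  set G := g θ y - meanUpdate g π θ with hG
  set G' := g θ' y - meanUpdate g π θ' with hG'
  have hL := hs.L₁_pos
  have h1 : ‖G‖ ≤ 2 * L₁ * (‖e‖ + ‖e'‖ + K) := by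
    have := _root_.norm_sub_le (g θ y) (meanUpdate g π θ)
    have := hs.norm_le y θ θstar
    have := hs.norm_meanUpdate_le (π := π) θ θstar
    nlinarith [norm_nonneg e']
  have h2 : ‖G - G'‖ ≤ 2 * L₁ * ‖θ - θ'‖ := by
    have e1 : G - G' = (g θ y - g θ' y) - (meanUpdate g π θ - meanUpdate g π θ') := by
      rw [hG, hG']; abel
    have := _root_.norm_sub_le (g θ y - g θ' y) (meanUpdate g π θ - meanUpdate g π θ')
    have := hs.norm_sub_le y θ θ'
    have := hs.norm_meanUpdate_sub_le (π := π) hg θ θ'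
    rw [e1]; linarith
  have h3 := norm_pow_smul_sub_le q e e'
  rw [hδ] at h3
  have e2 : inner ℝ ((‖e‖ ^ (2 * q)) • e) G - inner ℝ ((‖e'‖ ^ (2 * q)) • e') G'
      = inner ℝ ((‖e‖ ^ (2 * q)) • e - (‖e'‖ ^ (2 * q)) • e') G
        + inner ℝ ((‖e'‖ ^ (2 * q)) • e') (G - G') := by
    rw [inner_sub_left, inner_sub_right _ G G']; ring
  have h4 : ‖(‖e'‖ ^ (2 * q)) • e'‖ ≤ (‖e‖ + ‖e'‖) ^ (2 * q) * (‖e‖ + ‖e'‖ + K) := by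
    rw [norm_smul, norm_pow, norm_norm]
    gcongr
    · linarith [norm_nonneg e]
    · linarith [norm_nonneg e]
  rw [e2]
  calc _ ≤ ‖(‖e‖ ^ (2 * q)) • e - (‖e'‖ ^ (2 * q)) • e'‖ * ‖G‖
        + ‖(‖e'‖ ^ (2 * q)) • e'‖ * ‖G - G'‖ :=
        add_le_add (real_inner_le_norm _ _) (real_inner_le_norm _ _)
    _ ≤ ((2 * q + 1) * ((‖e‖ + ‖e'‖) ^ (2 * q) * ‖θ - θ'‖)) * (2 * L₁ * (‖e‖ + ‖e'‖ + K))
        + ((‖e‖ + ‖e'‖) ^ (2 * q) * (‖e‖ + ‖e'‖ + K)) * (2 * L₁ * ‖θ - θ'‖) := by gcongr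
    _ = _ := by ring

/-- The expansion with g = ḡ + (g - ḡ): strong monotonicity handles ḡ, and the Markov error is moved
from θ to a reference point θ', later the iterate one mixing time earlier. -/
lemma norm_add_smul_pow_le {μ α : ℝ} (hα : 0 ≤ α) (hs : SmoothLinearGrowth g L₁)
    (hg : ∀ θ, Measurable (g θ)) (hm : StronglyMonotone (meanUpdate g π) μ)
    (h0 : meanUpdate g π θstar = 0) (q : ℕ) (θ θ' z : Euc d) (y : X) :
    ‖θ + α • (g θ y + z) - θstar‖ ^ (2 * (q + 1))
      ≤ (1 - 2 * (q + 1) * α * μ) * ‖θ - θstar‖ ^ (2 * (q + 1))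
        + 2 * (q + 1) * α * inner ℝ ((‖θ - θstar‖ ^ (2 * q)) • (θ - θstar)) z
        + 2 * (q + 1) * α * markovError g π θstar q (θ', y)
        + 2 * (q + 1) * α * (4 * (q + 1) * L₁)
          * ((‖θ - θstar‖ + ‖θ' - θstar‖) ^ (2 * q) * ‖θ - θ'‖
            * (‖θ - θstar‖ + ‖θ' - θstar‖ + (1 + ‖θstar‖)))
        + (3 * q + 1) * (q + 1) * ((‖θ - θstar‖ + ‖α • (g θ y + z)‖) ^ (2 * q)
          * ‖α • (g θ y + z)‖ * ‖α • (g θ y + z)‖) := by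
  have h1 := norm_add_pow_le q (θ - θstar) (α • (g θ y + z))
  have h2 := hs.markovError_sub_le (π := π) (θstar := θstar) hg q θ θ' y
  have h3 := hm.inner_le θ θstar
  rw [h0, sub_zero] at h3
  have e1 : θ + α • (g θ y + z) - θstar = θ - θstar + α • (g θ y + z) := by abel
  have e2 : ‖θ - θstar‖ ^ (2 * q) * inner ℝ (θ - θstar) (α • (g θ y + z))
      = α * (inner ℝ ((‖θ - θstar‖ ^ (2 * q)) • (θ - θstar)) z
        + ‖θ - θstar‖ ^ (2 * q) * inner ℝ (θ - θstar) (meanUpdate g π θ)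
        + markovError g π θstar q (θ, y)) := by
    simp only [markovError, inner_smul_right, inner_smul_left, inner_add_right, inner_sub_right,
      conj_trivial]
    ring
  have h4 := mul_le_mul_of_nonneg_left h3 (by positivity : 0 ≤ ‖θ - θstar‖ ^ (2 * q))
  have e3 : ‖θ - θstar‖ ^ (2 * q) * (-μ * ‖θ - θstar‖ ^ 2)
      = -μ * ‖θ - θstar‖ ^ (2 * (q + 1)) := by ring
  rw [e3] at h4
  rw [e1]
  rw [e2] at h1
  have h5 : 2 * (q + 1) * (α * (inner ℝ ((‖θ - θstar‖ ^ (2 * q)) • (θ - θstar)) z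
        + ‖θ - θstar‖ ^ (2 * q) * inner ℝ (θ - θstar) (meanUpdate g π θ)
        + markovError g π θstar q (θ, y)))
      ≤ 2 * (q + 1) * (α * (inner ℝ ((‖θ - θstar‖ ^ (2 * q)) • (θ - θstar)) z
        + -μ * ‖θ - θstar‖ ^ (2 * (q + 1))
        + (markovError g π θstar q (θ', y) + 4 * (q + 1) * L₁
          * ((‖θ - θstar‖ + ‖θ' - θstar‖) ^ (2 * q) * ‖θ - θ'‖
            * (‖θ - θstar‖ + ‖θ' - θstar‖ + (1 + ‖θstar‖)))))) := by
    gcongr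
    linarith
  refine h1.trans ?_
  linarith

end Drift

/-- The standing assumptions on the projected stochastic approximation iteration. -/
structure SAModel {d : ℕ} {X Ω : Type*} [MeasurableSpace X] [MeasurableSpace Ω] (q : ℕ)
    (ν : Measure Ω) (P : Kernel X X) [IsMarkovKernel P] (π : Measure X)
    (L₁ L₂ μ α : ℝ) (β : ℝ≥0∞) (g : Euc d → X → Euc d) (θstar : Euc d)
    (x : ℕ → Ω → X) (ξ : ℕ → Euc d → Ω → Euc d) (θ₀ : Ω → Euc d) (τ : ℕ) : Prop where
  one_le_τ : 1 ≤ τ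
  tv_le : ∀ x, tvDist ((P ^ τ) x) π ≤ α
  measurable_update : ∀ θ, Measurable (g θ)
  smooth : SmoothLinearGrowth g L₁
  monotone : StronglyMonotone (meanUpdate g π) μ
  mean_eq_zero : meanUpdate g π θstar = 0
  α_pos : 0 < α
  mem_ball : ‖θstar‖ₑ ≤ β
  measurable_init : Measurable θ₀
  markov : IsMarkovChain ν P (history x (saIterate g α β x ξ θ₀) ξ) x
  noise : NoiseAssumption ν (history x (saIterate g α β x ξ θ₀) ξ) ξ θstar (q + 1) L₂

namespace SAModel

variable {d : ℕ} {X Ω : Type*} [MeasurableSpace X] [mΩ : MeasurableSpace Ω] {q : ℕ}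
  {ν : Measure Ω} {P : Kernel X X} [IsMarkovKernel P] {π : Measure X} {L₁ L₂ μ α : ℝ} {β : ℝ≥0∞} {g : Euc d → X → Euc d} {θstar : Euc d}
  {x : ℕ → Ω → X} {ξ : ℕ → Euc d → Ω → Euc d} {θ₀ : Ω → Euc d} {τ : ℕ}

lemma measurable_iterate (h : SAModel q ν P π L₁ L₂ μ α β g θstar x ξ θ₀ τ) (k : ℕ) :
    Measurable (saIterate g α β x ξ θ₀ k) :=
  _root_.measurable_saIterate h.smooth h.measurable_update h.markov.measurable h.noise
    h.measurable_init k

lemma measurable_half (h : SAModel q ν P π L₁ L₂ μ α β g θstar x ξ θ₀ τ) (k : ℕ) :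
    Measurable (saHalfIterate g α β x ξ θ₀ k) :=
  measurable_saHalfIterate_of h.smooth h.measurable_update h.markov.measurable h.noise
    (h.measurable_iterate k)

lemma history_le (h : SAModel q ν P π L₁ L₂ μ α β g θstar x ξ θ₀ τ) (k : ℕ) :
    history x (saIterate g α β x ξ θ₀) ξ k ≤ mΩ :=
  _root_.history_le h.markov.measurable h.measurable_iterate h.noise.measurable k

lemma eLpNorm_half_sub_le [IsProbabilityMeasure ν]
    (h : SAModel q ν P π L₁ L₂ μ α β g θstar x ξ θ₀ τ) (k : ℕ) {u : ℝ}
    (hu : 0 ≤ u)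
    (hU : eLpNorm (fun ω => saIterate g α β x ξ θ₀ k ω - θstar) ((2 * (q + 1) : ℕ) : ℝ≥0∞) ν
      ≤ ENNReal.ofReal u) :
    eLpNorm (fun ω => saHalfIterate g α β x ξ θ₀ k ω - saIterate g α β x ξ θ₀ k ω)
      ((2 * (q + 1) : ℕ) : ℝ≥0∞) ν
      ≤ ENNReal.ofReal (α * (L₁ + L₂) * (u + (1 + ‖θstar‖))) :=
  eLpNorm_saHalfIterate_sub_le h.smooth h.measurable_update h.markov.measurable h.noise h.α_pos.le
    (h.history_le k) (measurable_history_iterate k) hu hU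

end SAModel

/-! ### One step of the moment recursion -/

lemma one_le_two_mul_succ (q : ℕ) : (1 : ℝ≥0∞) ≤ ((2 * (q + 1) : ℕ) : ℝ≥0∞) := by
  exact_mod_cast (by omega : 1 ≤ 2 * (q + 1))

lemma eLpNorm_add_le_ofReal {Ω E : Type*} [MeasurableSpace Ω] {ν : Measure Ω}
    [NormedAddCommGroup E] {f g : Ω → E} {r : ℝ≥0∞} (hr : 1 ≤ r) {a b : ℝ} (ha : 0 ≤ a)
    (hb : 0 ≤ b) (hf : AEStronglyMeasurable f ν) (hg : AEStronglyMeasurable g ν)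
    (hfa : eLpNorm f r ν ≤ ENNReal.ofReal a) (hgb : eLpNorm g r ν ≤ ENNReal.ofReal b) :
    eLpNorm (fun ω => f ω + g ω) r ν ≤ ENNReal.ofReal (a + b) := by
  rw [ENNReal.ofReal_add ha hb]
  exact (eLpNorm_add_le hf hg hr).trans (add_le_add hfa hgb)

lemma integral_linear_combination_five {Ω : Type*} [MeasurableSpace Ω] {ν : Measure Ω}
    {f₀ f₁ f₂ f₃ f₄ : Ω → ℝ} (h₀ : Integrable f₀ ν) (h₁ : Integrable f₁ ν) (h₂ : Integrable f₂ ν)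
    (h₃ : Integrable f₃ ν) (h₄ : Integrable f₄ ν) (c₀ c₁ c₂ c₃ c₄ : ℝ) :
    Integrable (fun ω => c₀ * f₀ ω + c₁ * f₁ ω + c₂ * f₂ ω + c₃ * f₃ ω + c₄ * f₄ ω) ν ∧
    ∫ ω, (c₀ * f₀ ω + c₁ * f₁ ω + c₂ * f₂ ω + c₃ * f₃ ω + c₄ * f₄ ω) ∂ν
      = c₀ * ∫ ω, f₀ ω ∂ν + c₁ * ∫ ω, f₁ ω ∂ν + c₂ * ∫ ω, f₂ ω ∂ν + c₃ * ∫ ω, f₃ ω ∂ν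
        + c₄ * ∫ ω, f₄ ω ∂ν := by
  have i₀ := h₀.const_mul c₀
  have i₁ := h₁.const_mul c₁
  have i₂ := h₂.const_mul c₂
  have i₃ := h₃.const_mul c₃
  have i₄ := h₄.const_mul c₄
  refine ⟨(((i₀.add i₁).add i₂).add i₃).add i₄, ?_⟩
  rw [integral_add (by exact ((i₀.add i₁).add i₂).add i₃) i₄,
    integral_add (by exact (i₀.add i₁).add i₂) i₃, integral_add (by exact i₀.add i₁) i₂,
    integral_add i₀ i₁]
  simp only [integral_const_mul]

namespace SAModel

variable {d : ℕ} {X Ω : Type*} [MeasurableSpace X] [mΩ : MeasurableSpace Ω] {q : ℕ}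
  {ν : Measure Ω} [IsProbabilityMeasure ν] {P : Kernel X X} [IsMarkovKernel P] {π : Measure X}
  [IsProbabilityMeasure π] {L₁ L₂ μ α : ℝ} {β : ℝ≥0∞} {g : Euc d → X → Euc d} {θstar : Euc d}
  {x : ℕ → Ω → X} {ξ : ℕ → Euc d → Ω → Euc d} {θ₀ : Ω → Euc d} {τ : ℕ}

/-- One step of the moment recursion, in terms of bounds `u` on the current error and `D` on the
displacement over a mixing time. -/
lemma eLpNorm_half_pow_le (h : SAModel q ν P π L₁ L₂ μ α β g θstar x ξ θ₀ τ) (n : ℕ) {u D w : ℝ}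
    (hu : 0 < u) (hD : 0 < D) (hDu : D ≤ u) (hw : w = α * (L₁ + L₂) * (u + (1 + ‖θstar‖)))
    (hwu : w ≤ u) (hαμ : 2 * (q + 1) * α * μ ≤ 1)
    (hU : eLpNorm (fun ω => saIterate g α β x ξ θ₀ (n + τ) ω - θstar)
      ((2 * (q + 1) : ℕ) : ℝ≥0∞) ν ≤ ENNReal.ofReal u)
    (hδ : eLpNorm (fun ω => saIterate g α β x ξ θ₀ (n + τ) ω - saIterate g α β x ξ θ₀ n ω)
      ((2 * (q + 1) : ℕ) : ℝ≥0∞) ν ≤ ENNReal.ofReal D) :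
    eLpNorm (fun ω => saHalfIterate g α β x ξ θ₀ (n + τ) ω - θstar)
        ((2 * (q + 1) : ℕ) : ℝ≥0∞) ν ^ (2 * (q + 1))
      ≤ ENNReal.ofReal ((1 - 2 * (q + 1) * α * μ) * u ^ (2 * (q + 1))
        + 2 * (q + 1) * α * (2 * α * (2 * L₁
          * (3 * ((2 * u) ^ (2 * q) * (2 * u) * (2 * u + (1 + ‖θstar‖))))))
        + 2 * (q + 1) * α * (4 * (q + 1) * L₁)
          * (3 * ((3 * u) ^ (2 * q) * D * (3 * u + (1 + ‖θstar‖))))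
        + (3 * q + 1) * (q + 1) * (3 * ((2 * u) ^ (2 * q) * w * w))) := by
  have hr := one_le_two_mul_succ q
  have hα := h.α_pos
  have hL₁ := h.smooth.L₁_pos
  have hL₂ := h.noise.L₂_pos
  have hw0 : 0 < w := by rw [hw]; positivity
  set K := 1 + ‖θstar‖ with hK
  have hK0 : 0 < K := by positivity
  set k := n + τ with hk
  set θ := saIterate g α β x ξ θ₀ k with hθ
  set θ' := saIterate g α β x ξ θ₀ n with hθ'
  set z : Ω → Euc d := fun ω => ξ (k + 1) (θ ω) ω with hz
  set η : Ω → Euc d := fun ω => α • (g (θ ω) (x k ω) + z ω) with hη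
  have mθ : Measurable θ := h.measurable_iterate k
  have mθ' : Measurable θ' := h.measurable_iterate n
  have me : Measurable fun ω => θ ω - θstar := mθ.sub_const _
  have me' : Measurable fun ω => θ' ω - θstar := mθ'.sub_const _
  have mz : Measurable z :=
    measurable_field_apply (h.noise.measurable k) (h.noise.jointly_measurable k) mθ
  have eη : η = fun ω => saHalfIterate g α β x ξ θ₀ k ω - θ ω := by
    funext ω; simp [hη, saHalfIterate_eq, hθ, hz]
  have mη : Measurable η := by rw [eη]; exact (h.measurable_half k).sub mθ
  have nη : eLpNorm η ((2 * (q + 1) : ℕ) : ℝ≥0∞) ν ≤ ENNReal.ofReal w := by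
    rw [eη, hw]; exact h.eLpNorm_half_sub_le k hu.le hU
  have nz : eLpNorm z ((2 * (q + 1) : ℕ) : ℝ≥0∞) ν ≤ ENNReal.ofReal (L₂ * (u + 1)) :=
    h.noise.eLpNorm_apply_le (h.history_le k) (measurable_history_iterate k) hu.le hU
  -- The earlier error is at most u + D ≤ 2u, so every term can be expressed through the current
  -- error.
  have ne' : eLpNorm (fun ω => θ' ω - θstar) ((2 * (q + 1) : ℕ) : ℝ≥0∞) ν
      ≤ ENNReal.ofReal (2 * u) := by
    have h1 := eLpNorm_add_le_ofReal hr hu.le hD.le me.aestronglyMeasurable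
      (mθ'.sub mθ).aestronglyMeasurable hU (by rw [eLpNorm_sub_comm]; exact hδ)
    refine le_trans (le_of_eq ?_) (h1.trans (ENNReal.ofReal_le_ofReal (by linarith)))
    congr 1
    funext ω
    simp only [Pi.sub_apply]; abel
  have normU : eLpNorm (fun ω => ‖θ ω - θstar‖) ((2 * (q + 1) : ℕ) : ℝ≥0∞) ν
      ≤ ENNReal.ofReal u := (eLpNorm_norm _).trans_le hU
  have normU' : eLpNorm (fun ω => ‖θ' ω - θstar‖) ((2 * (q + 1) : ℕ) : ℝ≥0∞) ν
      ≤ ENNReal.ofReal (2 * u) := (eLpNorm_norm _).trans_le ne'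
  have normη : eLpNorm (fun ω => ‖η ω‖) ((2 * (q + 1) : ℕ) : ℝ≥0∞) ν ≤ ENNReal.ofReal w :=
    (eLpNorm_norm _).trans_le nη
  have ns : eLpNorm (fun ω => ‖θ ω - θstar‖ + ‖θ' ω - θstar‖) ((2 * (q + 1) : ℕ) : ℝ≥0∞) ν
      ≤ ENNReal.ofReal (3 * u) := by
    have := eLpNorm_add_le_ofReal hr hu.le (by positivity) me.norm.aestronglyMeasurable
      me'.norm.aestronglyMeasurable normU normU'
    rwa [show u + 2 * u = 3 * u by ring] at this
  have nK : eLpNorm (fun _ : Ω => K) ((2 * (q + 1) : ℕ) : ℝ≥0∞) ν ≤ ENNReal.ofReal K := by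
    rw [eLpNorm_const _ (by positivity) (IsProbabilityMeasure.ne_zero ν)]
    simp [Real.enorm_of_nonneg hK0.le]
  -- the four error terms
  have T0 : Integrable (fun ω => ‖θ ω - θstar‖ ^ (2 * (q + 1))) ν ∧
      ∫ ω, ‖θ ω - θstar‖ ^ (2 * (q + 1)) ∂ν ≤ u ^ (2 * (q + 1)) :=
    ⟨MemLp.integrable_norm_pow ⟨me.aestronglyMeasurable, hU.trans_lt ENNReal.ofReal_lt_top⟩
      (by omega), integral_norm_pow_le me.aestronglyMeasurable hu.le hU⟩
  have T1 : Integrable (fun ω => (inner ℝ ((‖θ ω - θstar‖ ^ (2 * q)) • (θ ω - θstar)) (z ω) : ℝ)) ν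
      ∧ ∫ ω, (inner ℝ ((‖θ ω - θstar‖ ^ (2 * q)) • (θ ω - θstar)) (z ω) : ℝ) ∂ν = 0 := by
    have hV : Measurable fun a : Euc d => (‖a - θstar‖ ^ (2 * q)) • (a - θstar) :=
      ((measurable_id.sub_const θstar).norm.pow_const _).smul (measurable_id.sub_const θstar)
    have hi : Integrable
        (fun ω => (inner ℝ ((‖θ ω - θstar‖ ^ (2 * q)) • (θ ω - θstar)) (z ω) : ℝ)) ν := by
      refine (integrable_and_integral_pow_mul_mul_le hu hu (c := L₂ * (u + 1)) (by positivity)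
        me.norm.aestronglyMeasurable me.norm.aestronglyMeasurable mz.norm.aestronglyMeasurable
        (fun _ => norm_nonneg _) (fun _ => norm_nonneg _) (fun _ => norm_nonneg _) normU normU
        ((eLpNorm_norm _).trans_le nz)).1.mono'
        (((hV.comp mθ).inner mz).aestronglyMeasurable) (Filter.Eventually.of_forall fun ω => ?_)
      refine (abs_real_inner_le_norm _ _).trans (le_of_eq ?_)
      rw [norm_smul, norm_pow, norm_norm]
    exact ⟨hi, h.noise.integral_inner_eq_zero (by omega) (h.history_le k)
      (measurable_history_iterate k) hV hi⟩
  -- Here the mixing time acts: θ' is known at time n, while the state is observed τ steps later,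
  -- with total variation error α.
  have T2 : Integrable (fun ω => markovError g π θstar q (θ' ω, x k ω)) ν ∧
      ∫ ω, markovError g π θstar q (θ' ω, x k ω) ∂ν ≤ 2 * α * (2 * L₁
          * (3 * ((2 * u) ^ (2 * q) * (2 * u) * (2 * u + K)))) := by
    have hb := integrable_and_integral_pow_mul_mul_le (by positivity : 0 < 2 * u)
      (by positivity : 0 < 2 * u) (by positivity : 0 < 2 * u + K)
      me'.norm.aestronglyMeasurable me'.norm.aestronglyMeasurable
      (me'.norm.add_const K).aestronglyMeasurable
      (fun _ => norm_nonneg _) (fun _ => norm_nonneg _) (fun _ => by positivity) normU' normU'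
      (eLpNorm_add_le_ofReal hr (by positivity) hK0.le me'.norm.aestronglyMeasurable
        aestronglyMeasurable_const normU' nK)
    have hm := h.markov.integral_prodMk_add_le h.history_le history_mono measurable_history_state
      n τ h.tv_le (measurable_history_iterate n)
      (h.smooth.measurable_markovError (θstar := θstar) h.measurable_update q)
      (b := fun a => 2 * L₁ *
        (‖a - θstar‖ ^ (2 * q) * ‖a - θstar‖ * (‖a - θstar‖ + (1 + ‖θstar‖))))
      (fun a y => h.smooth.abs_markovError_le q a y) (hb.1.const_mul _)
      (fun a => h.smooth.integral_inner_sub_meanUpdate h.measurable_update a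
        ((‖a - θstar‖ ^ (2 * q)) • (a - θstar)))
    refine ⟨hm.1, hm.2.trans ?_⟩
    rw [integral_const_mul]
    gcongr
    exact hb.2
  have T3 := integrable_and_integral_pow_mul_mul_le (by positivity : 0 < 3 * u) hD
      (by positivity : 0 < 3 * u + K) (me.norm.add me'.norm).aestronglyMeasurable
      (mθ.sub mθ').norm.aestronglyMeasurable
      ((me.norm.add me'.norm).add_const K).aestronglyMeasurable
      (fun _ => by simp only [Pi.add_apply]; positivity) (fun _ => norm_nonneg _)
      (fun _ => by simp only [Pi.add_apply]; positivity) ns ((eLpNorm_norm _).trans_le hδ)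
      (eLpNorm_add_le_ofReal hr (by positivity) hK0.le
        (me.norm.add me'.norm).aestronglyMeasurable aestronglyMeasurable_const ns nK)
  have T4 := integrable_and_integral_pow_mul_mul_le (by positivity : 0 < 2 * u) hw0 hw0
      (me.norm.add mη.norm).aestronglyMeasurable mη.norm.aestronglyMeasurable
      mη.norm.aestronglyMeasurable
      (fun _ => by simp only [Pi.add_apply]; positivity) (fun _ => norm_nonneg _)
      (fun _ => norm_nonneg _)
      ((eLpNorm_add_le_ofReal hr hu.le hw0.le me.norm.aestronglyMeasurable
        mη.norm.aestronglyMeasurable normU normη).trans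
          (ENNReal.ofReal_le_ofReal (by linarith))) normη normη
  simp only [Pi.add_apply, Pi.sub_apply] at T3 T4
  have hhalf : MemLp (fun ω => saHalfIterate g α β x ξ θ₀ k ω - θstar)
      ((2 * (q + 1) : ℕ) : ℝ≥0∞) ν := by
    refine ⟨((h.measurable_half k).sub_const _).aestronglyMeasurable, ?_⟩
    have h1 := eLpNorm_add_le_ofReal hr hu.le hw0.le me.aestronglyMeasurable
      mη.aestronglyMeasurable hU nη
    refine lt_of_le_of_lt (le_of_eq ?_) (h1.trans_lt ENNReal.ofReal_lt_top)
    congr 1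
    funext ω
    simp only [eη]; abel
  rw [eLpNorm_pow_eq_ofReal_integral hhalf]
  refine ENNReal.ofReal_le_ofReal ?_
  obtain ⟨hint, hsum⟩ := integral_linear_combination_five T0.1 T1.1 T2.1 T3.1 T4.1
    (1 - 2 * (q + 1) * α * μ) (2 * (q + 1) * α) (2 * (q + 1) * α)
    (2 * (q + 1) * α * (4 * (q + 1) * L₁)) ((3 * q + 1) * (q + 1))
  refine (integral_mono (hhalf.integrable_norm_pow (by omega)) hint fun ω =>
    norm_add_smul_pow_le hα.le h.smooth h.measurable_update h.monotone h.mean_eq_zero q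
      (θ ω) (θ' ω) (z ω) (x k ω)).trans ?_
  rw [hsum, T1.2, mul_zero, add_zero]
  -- Needed so that the moment in the contraction term may be replaced by its upper bound.
  have c0 : 0 ≤ 1 - 2 * (q + 1) * α * μ := by linarith
  gcongr
  · exact T0.2
  · exact T2.2
  · exact T3.2
  · exact T4.2

end SAModel

/-! ### Scalar estimates: the drift dominates the errors -/

lemma two_mul_pow_two_mul (u : ℝ) (q : ℕ) : (2 * u) ^ (2 * q) = 4 ^ q * u ^ (2 * q) := by
  rw [mul_pow, pow_mul]; norm_num

lemma three_mul_pow_two_mul (u : ℝ) (q : ℕ) : (3 * u) ^ (2 * q) = 9 ^ q * u ^ (2 * q) := by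
  rw [mul_pow, pow_mul]; norm_num

lemma four_pow_le_nine_pow (q : ℕ) : (4 : ℝ) ^ q ≤ 9 ^ q := by gcongr; norm_num

/-- This and the next two lemmas measure the error terms in the common unit (q+1)² 9^q αμ
u^{2(q+1)}, after multiplication by A. -/
lemma mixing_term_le (q : ℕ) {u α L₁ L μ A b : ℝ} (hu : 0 < u) (hα : 0 < α) (hA : 0 < A)
    (hμ : 0 < μ) (hL₁L : L₁ ≤ L) (hb : 0 ≤ b) (h : A * (α * L * b) ≤ 3 * (μ * u)) :
    A * (2 * (q + 1) * α * (2 * α * (2 * L₁ * (3 * ((2 * u) ^ (2 * q) * (2 * u) * b)))))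
      ≤ 144 * ((q + 1) ^ 2 * 9 ^ q * (α * μ * u ^ (2 * (q + 1)))) := by
  have h49 := four_pow_le_nine_pow q
  have hq : (0 : ℝ) ≤ q := q.cast_nonneg
  calc _ ≤ A * (2 * (q + 1) * α * (2 * α * (2 * L
        * (3 * ((2 * u) ^ (2 * q) * (2 * u) * b))))) := by gcongr
    _ = 48 * (q + 1) * 4 ^ q * (α * u ^ (2 * q) * u) * (A * (α * L * b)) := by
        rw [two_mul_pow_two_mul]; ring
    _ ≤ 48 * (q + 1) * 4 ^ q * (α * u ^ (2 * q) * u) * (3 * (μ * u)) := by gcongr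
    _ = 144 * ((q + 1) * 4 ^ q * (α * μ * u ^ (2 * (q + 1)))) := by ring
    _ ≤ 144 * ((q + 1) ^ 2 * 9 ^ q * (α * μ * u ^ (2 * (q + 1)))) := by
        gcongr
        nlinarith

lemma displacement_term_le (q : ℕ) {u α L₁ L μ A D b : ℝ} (hu : 0 < u) (hα : 0 < α) (hA : 0 < A)
    (hL₁L : L₁ ≤ L) (hD : 0 ≤ D) (hb : 0 ≤ b) (h : A * (L * (D * b)) ≤ 32 * (μ * u ^ 2)) :
    A * (2 * (q + 1) * α * (4 * (q + 1) * L₁) * (3 * ((3 * u) ^ (2 * q) * D * b)))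
      ≤ 768 * ((q + 1) ^ 2 * 9 ^ q * (α * μ * u ^ (2 * (q + 1)))) := by
  calc _ ≤ A * (2 * (q + 1) * α * (4 * (q + 1) * L) * (3 * ((3 * u) ^ (2 * q) * D * b))) := by
        gcongr
    _ = 24 * (q + 1) ^ 2 * 9 ^ q * (α * u ^ (2 * q)) * (A * (L * (D * b))) := by
        rw [three_mul_pow_two_mul]; ring
    _ ≤ 24 * (q + 1) ^ 2 * 9 ^ q * (α * u ^ (2 * q)) * (32 * (μ * u ^ 2)) := by gcongr
    _ = _ := by ring

lemma second_order_term_le (q : ℕ) {u α μ A w : ℝ} (hu : 0 < u) (hA : 0 < A)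
    (h : A * (w * w) ≤ 4 * (α * μ * u ^ 2)) :
    A * ((3 * q + 1) * (q + 1) * (3 * ((2 * u) ^ (2 * q) * w * w)))
      ≤ 36 * ((q + 1) ^ 2 * 9 ^ q * (α * μ * u ^ (2 * (q + 1)))) := by
  have h49 := four_pow_le_nine_pow q
  have hq : (0 : ℝ) ≤ q := q.cast_nonneg
  have hw : 0 ≤ A * (w * w) := mul_nonneg hA.le (mul_self_nonneg w)
  have h1 : (3 * (q : ℝ) + 1) * (q + 1) ≤ 3 * (q + 1) ^ 2 := by nlinarith
  calc _ = 3 * ((3 * q + 1) * (q + 1)) * 4 ^ q * u ^ (2 * q) * (A * (w * w)) := by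
        rw [two_mul_pow_two_mul]; ring
    _ ≤ 3 * (3 * (q + 1) ^ 2) * 9 ^ q * u ^ (2 * q) * (4 * (α * μ * u ^ 2)) := by gcongr
    _ = _ := by ring

/-- The drift beats the error terms as soon as `u ≥ ε K`, where `ε² μ = A α τ L²`. -/
lemma drift_bound_le (q : ℕ) {u K α L₁ L₂ τ μ ε A : ℝ} (hK : 0 < K) (hα : 0 < α)
    (hL₁ : 0 < L₁) (hL₂ : 0 < L₂) (hL : 1 ≤ L₁ + L₂) (hτ : 1 ≤ τ) (hμ : 0 < μ) (hε : 0 < ε)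
    (hε1 : ε ≤ 1) (hA : A = 1000 * (q + 1) ^ 2 * 9 ^ q)
    (hεA : ε ^ 2 * μ = A * (α * τ * (L₁ + L₂) ^ 2)) (hu : ε * K ≤ u) :
    (1 - 2 * (q + 1) * α * μ) * u ^ (2 * (q + 1))
        + 2 * (q + 1) * α * (2 * α * (2 * L₁ * (3 * ((2 * u) ^ (2 * q) * (2 * u) * (2 * u + K)))))
        + 2 * (q + 1) * α * (4 * (q + 1) * L₁)
          * (3 * ((3 * u) ^ (2 * q) * (4 * τ * (α * (L₁ + L₂)) * (u + K)) * (3 * u + K)))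
        + (3 * q + 1) * (q + 1) * (3 * ((2 * u) ^ (2 * q) * (α * (L₁ + L₂) * (u + K))
          * (α * (L₁ + L₂) * (u + K))))
      ≤ (1 - α * μ) * u ^ (2 * (q + 1)) := by
  set L := L₁ + L₂ with hLdef
  have hu0 : 0 < u := lt_of_lt_of_le (by positivity) hu
  have hL0 : 0 < L := by linarith
  have hτ0 : 0 < τ := by linarith
  have hq : (0 : ℝ) ≤ q := q.cast_nonneg
  have hA0 : 0 < A := by rw [hA]; positivity
  have hεu : ε * u ≤ u := by nlinarith
  -- Each factor containing K needs one ε to be absorbed into u. The displacement and second-order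
  -- terms have two such factors, which is why ε² is the quantity proportional to ατL²/μ.
  have b1 : ε * (u + K) ≤ 2 * u := by nlinarith
  have b2 : ε * (2 * u + K) ≤ 3 * u := by nlinarith
  have b3 : ε * (3 * u + K) ≤ 4 * u := by nlinarith
  have hL2 : L ≤ L ^ 2 := by nlinarith
  have b4 : A * (α * L) ≤ ε ^ 2 * μ := by
    rw [hεA]
    have : α * L ≤ α * τ * L ^ 2 := by
      calc α * L = α * 1 * L := by ring
        _ ≤ α * τ * L ^ 2 := by gcongr
    gcongr
  have b5 : A * (α * L ^ 2) ≤ ε ^ 2 * μ := by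
    rw [hεA]
    have : α * L ^ 2 ≤ α * τ * L ^ 2 := by
      calc α * L ^ 2 = α * 1 * L ^ 2 := by ring
        _ ≤ α * τ * L ^ 2 := by gcongr
    gcongr
  have w1 : A * (α * L * (u + K) * (α * L * (u + K))) ≤ 4 * (α * μ * u ^ 2) := by
    have h1 : ε ^ 2 * (A * (α * L * (u + K) * (α * L * (u + K))))
        ≤ ε ^ 2 * (4 * (α * μ * u ^ 2)) := by
      calc ε ^ 2 * (A * (α * L * (u + K) * (α * L * (u + K))))
          = (A * (α * L ^ 2)) * α * (ε * (u + K)) ^ 2 := by ring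
        _ ≤ (ε ^ 2 * μ) * α * (2 * u) ^ 2 := by gcongr
        _ = _ := by ring
    exact le_of_mul_le_mul_left h1 (by positivity)
  have w2 : A * (L * (4 * τ * (α * L) * (u + K) * (3 * u + K))) ≤ 32 * (μ * u ^ 2) := by
    have h1 : ε ^ 2 * (A * (L * (4 * τ * (α * L) * (u + K) * (3 * u + K))))
        ≤ ε ^ 2 * (32 * (μ * u ^ 2)) := by
      calc ε ^ 2 * (A * (L * (4 * τ * (α * L) * (u + K) * (3 * u + K))))
          = 4 * (A * (α * τ * L ^ 2)) * (ε * (u + K)) * (ε * (3 * u + K)) := by ring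
        _ = 4 * (ε ^ 2 * μ) * (ε * (u + K)) * (ε * (3 * u + K)) := by rw [hεA]
        _ ≤ 4 * (ε ^ 2 * μ) * (2 * u) * (4 * u) := by gcongr
        _ = _ := by ring
    exact le_of_mul_le_mul_left h1 (by positivity)
  have w3 : A * (α * L * (2 * u + K)) ≤ 3 * (μ * u) := by
    calc A * (α * L * (2 * u + K)) = (A * (α * L)) * (2 * u + K) := by ring
      _ ≤ (ε ^ 2 * μ) * (2 * u + K) := by gcongr
      _ = ε * μ * (ε * (2 * u + K)) := by ring
      _ ≤ 1 * μ * (3 * u) := by gcongr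
      _ = _ := by ring
  have hL₁L : L₁ ≤ L := by linarith
  have t2 := mixing_term_le q hu0 hα hA0 hμ hL₁L (by positivity) w3
  have t3 := displacement_term_le q hu0 hα hA0 hL₁L (by positivity) (by positivity) w2
  have t4 := second_order_term_le q hu0 hA0 w1
  set M := u ^ (2 * (q + 1)) with hM
  have hM0 : 0 < M := by positivity
  -- The shares add up to 144 + 768 + 36 = 948, which is what the 1000 in A has to exceed.
  have key : ∀ a b c N D : ℝ, 0 ≤ N → A * D = 1000 * N → A * a ≤ 144 * N → A * b ≤ 768 * N →
      A * c ≤ 36 * N → a + b + c ≤ D := by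
    intro a b c N D hN hD ha hb hc
    refine le_of_mul_le_mul_left ?_ hA0
    rw [hD, mul_add, mul_add]
    linarith
  have t5 := key _ _ _ (((q + 1) ^ 2 * 9 ^ q) * (α * μ * M)) (α * μ * M) (by positivity)
    (by rw [hA]; ring) t2 t3 t4
  -- Of the 2q + 2 units of drift αμ, one pays for the errors and one is kept; the other 2q are
  -- discarded.
  have t6 : 0 ≤ q * (α * μ * M) := by positivity
  have fin : ∀ a b c : ℝ, a + b + c ≤ α * μ * M →
      (1 - 2 * (q + 1) * α * μ) * M + a + b + c ≤ (1 - α * μ) * M := by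
    intro a b c habc
    linarith only [habc, t6]
  exact fin _ _ _ t5

lemma growth_step_le {u K S : ℝ} (hS : 0 ≤ S) (hK : 0 ≤ K) (hu : 0 ≤ u) (i : ℕ)
    (hi : 2 * i * S ≤ 1) : S * (u + 2 * i * S * (u + K) + K) ≤ S * (2 * (u + K)) := by
  have : 2 * i * S * (u + K) ≤ 1 * (u + K) := by gcongr
  gcongr
  linarith

/-! ### A priori growth and displacement of the iterates -/

namespace SAModel

variable {d : ℕ} {X Ω : Type*} [MeasurableSpace X] [mΩ : MeasurableSpace Ω] {q : ℕ}
  {ν : Measure Ω} {P : Kernel X X} [IsMarkovKernel P] {π : Measure X}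
  {L₁ L₂ μ α : ℝ} {β : ℝ≥0∞} {g : Euc d → X → Euc d} {θstar : Euc d}
  {x : ℕ → Ω → X} {ξ : ℕ → Euc d → Ω → Euc d} {θ₀ : Ω → Euc d} {τ : ℕ}

lemma eLpNorm_succ_le (h : SAModel q ν P π L₁ L₂ μ α β g θstar x ξ θ₀ τ) (k : ℕ) :
    eLpNorm (fun ω => saIterate g α β x ξ θ₀ (k + 1) ω - θstar) ((2 * (q + 1) : ℕ) : ℝ≥0∞) ν
      ≤ eLpNorm (fun ω => saHalfIterate g α β x ξ θ₀ k ω - θstar)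
        ((2 * (q + 1) : ℕ) : ℝ≥0∞) ν :=
  eLpNorm_mono fun ω => norm_saIterate_succ_sub_le h.mem_ball k ω

variable [IsProbabilityMeasure ν]

lemma eLpNorm_half_le (h : SAModel q ν P π L₁ L₂ μ α β g θstar x ξ θ₀ τ) {k : ℕ} {u : ℝ}
    (hu : 0 ≤ u)
    (hU : eLpNorm (fun ω => saIterate g α β x ξ θ₀ k ω - θstar) ((2 * (q + 1) : ℕ) : ℝ≥0∞) ν
      ≤ ENNReal.ofReal u) :
    eLpNorm (fun ω => saHalfIterate g α β x ξ θ₀ k ω - θstar) ((2 * (q + 1) : ℕ) : ℝ≥0∞) ν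
      ≤ ENNReal.ofReal (u + α * (L₁ + L₂) * (u + (1 + ‖θstar‖))) := by
  have hα := h.α_pos
  have hL₁ := h.smooth.L₁_pos
  have hL₂ := h.noise.L₂_pos
  refine le_trans (le_of_eq ?_) (eLpNorm_add_le_ofReal (one_le_two_mul_succ q) hu (by positivity)
    ((h.measurable_iterate k).sub_const θstar).aestronglyMeasurable
    ((h.measurable_half k).sub (h.measurable_iterate k)).aestronglyMeasurable hU
    (h.eLpNorm_half_sub_le k hu hU))
  congr 1
  funext ω
  simp only [Pi.sub_apply]; abel

/-- Finiteness propagates from the initial moment, so later norms can be treated as real numbers and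
absorbed into inequalities. -/
lemma eLpNorm_ne_top (h : SAModel q ν P π L₁ L₂ μ α β g θstar x ξ θ₀ τ)
    (h0 : eLpNorm (fun ω => θ₀ ω - θstar) ((2 * (q + 1) : ℕ) : ℝ≥0∞) ν ≠ ∞) (k : ℕ) :
    eLpNorm (fun ω => saIterate g α β x ξ θ₀ k ω - θstar) ((2 * (q + 1) : ℕ) : ℝ≥0∞) ν ≠ ∞ := by
  induction k with
  | zero => exact h0
  | succ k ih =>
    exact (((h.eLpNorm_succ_le k).trans (h.eLpNorm_half_le ENNReal.toReal_nonneg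
      (ENNReal.ofReal_toReal ih).ge)).trans_lt ENNReal.ofReal_lt_top).ne

/-- Growth of the error over a short initial phase. -/
lemma eLpNorm_iterate_le_of_init (h : SAModel q ν P π L₁ L₂ μ α β g θstar x ξ θ₀ τ) {u : ℝ}
    (hu : 0 ≤ u) (h0 : eLpNorm (fun ω => θ₀ ω - θstar) ((2 * (q + 1) : ℕ) : ℝ≥0∞) ν
      ≤ ENNReal.ofReal u) (j : ℕ) (hj : 2 * j * (α * (L₁ + L₂)) ≤ 1) :
    eLpNorm (fun ω => saIterate g α β x ξ θ₀ j ω - θstar) ((2 * (q + 1) : ℕ) : ℝ≥0∞) ν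
      ≤ ENNReal.ofReal (u + 2 * j * (α * (L₁ + L₂)) * (u + (1 + ‖θstar‖))) ∧
    eLpNorm (fun ω => saHalfIterate g α β x ξ θ₀ j ω - θstar) ((2 * (q + 1) : ℕ) : ℝ≥0∞) ν
      ≤ ENNReal.ofReal (u + 2 * (j + 1) * (α * (L₁ + L₂)) * (u + (1 + ‖θstar‖))) := by
  have hα := h.α_pos
  have hL₁ := h.smooth.L₁_pos
  have hL₂ := h.noise.L₂_pos
  have hS : 0 < α * (L₁ + L₂) := by positivity
  have step : ∀ i : ℕ, 2 * i * (α * (L₁ + L₂)) ≤ 1 →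
      eLpNorm (fun ω => saIterate g α β x ξ θ₀ i ω - θstar) ((2 * (q + 1) : ℕ) : ℝ≥0∞) ν
        ≤ ENNReal.ofReal (u + 2 * i * (α * (L₁ + L₂)) * (u + (1 + ‖θstar‖))) →
      eLpNorm (fun ω => saHalfIterate g α β x ξ θ₀ i ω - θstar) ((2 * (q + 1) : ℕ) : ℝ≥0∞) ν
        ≤ ENNReal.ofReal (u + 2 * (i + 1) * (α * (L₁ + L₂)) * (u + (1 + ‖θstar‖))) := by
    intro i hi hi'
    refine (h.eLpNorm_half_le (by positivity) hi').trans (ENNReal.ofReal_le_ofReal ?_)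
    have := growth_step_le hS.le (by positivity : 0 ≤ 1 + ‖θstar‖) hu i hi
    linarith
  have main : eLpNorm (fun ω => saIterate g α β x ξ θ₀ j ω - θstar)
      ((2 * (q + 1) : ℕ) : ℝ≥0∞) ν
      ≤ ENNReal.ofReal (u + 2 * j * (α * (L₁ + L₂)) * (u + (1 + ‖θstar‖))) := by
    induction j with
    | zero => rw [Nat.cast_zero, mul_zero, zero_mul, zero_mul, add_zero]; exact h0
    | succ j ih =>
      rw [Nat.cast_succ] at hj ⊢
      have hj' : 2 * j * (α * (L₁ + L₂)) ≤ 1 := by linarith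
      exact (h.eLpNorm_succ_le j).trans (step j hj' (ih hj'))
  exact ⟨main, step j hj main⟩

/-- Displacement over a short time, once the iterates are in the ball. -/
lemma eLpNorm_iterate_add_sub_le (h : SAModel q ν P π L₁ L₂ μ α β g θstar x ξ θ₀ τ) {v : ℝ}
    (hv : 0 ≤ v) {n : ℕ} (hn : 1 ≤ n)
    (hV : eLpNorm (fun ω => saIterate g α β x ξ θ₀ n ω - θstar) ((2 * (q + 1) : ℕ) : ℝ≥0∞) ν
      ≤ ENNReal.ofReal v) (j : ℕ) (hj : 2 * j * (α * (L₁ + L₂)) ≤ 1) :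
    eLpNorm (fun ω => saIterate g α β x ξ θ₀ (n + j) ω - saIterate g α β x ξ θ₀ n ω)
      ((2 * (q + 1) : ℕ) : ℝ≥0∞) ν
      ≤ ENNReal.ofReal (2 * j * (α * (L₁ + L₂)) * (v + (1 + ‖θstar‖))) := by
  have hα := h.α_pos
  have hL₁ := h.smooth.L₁_pos
  have hL₂ := h.noise.L₂_pos
  have hS : 0 < α * (L₁ + L₂) := by positivity
  have hr := one_le_two_mul_succ q
  have mθ := h.measurable_iterate
  induction j with
  | zero => simp
  | succ j ih =>
    rw [Nat.cast_succ] at hj ⊢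
    have hj' : 2 * j * (α * (L₁ + L₂)) ≤ 1 := by linarith
    have hd := ih hj'
    have hU : eLpNorm (fun ω => saIterate g α β x ξ θ₀ (n + j) ω - θstar)
        ((2 * (q + 1) : ℕ) : ℝ≥0∞) ν
        ≤ ENNReal.ofReal (v + 2 * j * (α * (L₁ + L₂)) * (v + (1 + ‖θstar‖))) := by
      refine le_trans (le_of_eq ?_) (eLpNorm_add_le_ofReal hr hv (by positivity)
        ((mθ n).sub_const θstar).aestronglyMeasurable
        ((mθ (n + j)).sub (mθ n)).aestronglyMeasurable hV hd)
      congr 1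
      funext ω
      simp only [Pi.sub_apply]; abel
    have hinc : eLpNorm (fun ω => saIterate g α β x ξ θ₀ (n + j + 1) ω
        - saIterate g α β x ξ θ₀ (n + j) ω) ((2 * (q + 1) : ℕ) : ℝ≥0∞) ν
        ≤ ENNReal.ofReal (α * (L₁ + L₂) * (2 * (v + (1 + ‖θstar‖)))) := by
      refine (eLpNorm_mono fun ω =>
        norm_saIterate_succ_sub_saIterate_le (by omega) ω).trans
        ((h.eLpNorm_half_sub_le (n + j) (by positivity) hU).trans (ENNReal.ofReal_le_ofReal ?_))
      exact growth_step_le hS.le (by positivity : 0 ≤ 1 + ‖θstar‖) hv j hj'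
    refine le_trans (le_of_eq ?_) ((eLpNorm_add_le_ofReal hr (by positivity) (by positivity)
        ((mθ (n + j + 1)).sub (mθ (n + j))).aestronglyMeasurable
        ((mθ (n + j)).sub (mθ n)).aestronglyMeasurable hinc hd).trans
          (ENNReal.ofReal_le_ofReal (le_of_eq (by ring))))
    congr 1
    funext ω
    simp only [Pi.sub_apply, ← add_assoc]; abel

/-- Displacement over a mixing time, in terms of the error at its end. -/
lemma eLpNorm_iterate_sub_le (h : SAModel q ν P π L₁ L₂ μ α β g θstar x ξ θ₀ τ)
    (h0 : eLpNorm (fun ω => θ₀ ω - θstar) ((2 * (q + 1) : ℕ) : ℝ≥0∞) ν ≠ ∞) {u : ℝ}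
    (hu : 0 ≤ u) {n : ℕ} (hn : 1 ≤ n) (hτ : 4 * τ * (α * (L₁ + L₂)) ≤ 1)
    (hU : eLpNorm (fun ω => saIterate g α β x ξ θ₀ (n + τ) ω - θstar)
      ((2 * (q + 1) : ℕ) : ℝ≥0∞) ν ≤ ENNReal.ofReal u) :
    eLpNorm (fun ω => saIterate g α β x ξ θ₀ (n + τ) ω - saIterate g α β x ξ θ₀ n ω)
      ((2 * (q + 1) : ℕ) : ℝ≥0∞) ν
      ≤ ENNReal.ofReal (4 * τ * (α * (L₁ + L₂)) * (u + (1 + ‖θstar‖))) := by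
  have hα := h.α_pos
  have hL₁ := h.smooth.L₁_pos
  have hL₂ := h.noise.L₂_pos
  have hS : 0 < α * (L₁ + L₂) := by positivity
  have mθ := h.measurable_iterate
  have hfin := h.eLpNorm_ne_top h0 n
  set v := (eLpNorm (fun ω => saIterate g α β x ξ θ₀ n ω - θstar)
    ((2 * (q + 1) : ℕ) : ℝ≥0∞) ν).toReal with hv
  have hv0 : 0 ≤ v := ENNReal.toReal_nonneg
  have hV := ENNReal.ofReal_toReal hfin
  rw [← hv] at hV
  have hd := h.eLpNorm_iterate_add_sub_le hv0 hn hV.ge τ (by nlinarith)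
  -- The forward estimate is in terms of the earlier error v. As 2ταL ≤ 1/2, this inequality can be
  -- solved for v, giving v + K ≤ 2(u + K).
  have hvu : v ≤ u + 2 * τ * (α * (L₁ + L₂)) * (v + (1 + ‖θstar‖)) := by
    rw [← ENNReal.ofReal_le_ofReal_iff (by positivity), hV]
    refine le_trans (le_of_eq ?_) (eLpNorm_add_le_ofReal (one_le_two_mul_succ q) hu (by positivity)
      ((mθ (n + τ)).sub_const θstar).aestronglyMeasurable
      ((mθ n).sub (mθ (n + τ))).aestronglyMeasurable hU (by rw [eLpNorm_sub_comm]; exact hd))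
    congr 1
    funext ω
    simp only [Pi.sub_apply]; abel
  refine hd.trans (ENNReal.ofReal_le_ofReal ?_)
  have hK0 : 0 < 1 + ‖θstar‖ := by positivity
  have h1 : 4 * τ * (α * (L₁ + L₂)) * (v + (1 + ‖θstar‖)) ≤ 1 * (v + (1 + ‖θstar‖)) := by gcongr
  have h2 : v + (1 + ‖θstar‖) ≤ 2 * (u + (1 + ‖θstar‖)) := by linarith
  calc 2 * τ * (α * (L₁ + L₂)) * (v + (1 + ‖θstar‖))
      ≤ 2 * τ * (α * (L₁ + L₂)) * (2 * (u + (1 + ‖θstar‖))) := by gcongr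
    _ = _ := by ring

end SAModel

/-! ### Contraction down to the threshold, and iteration -/

lemma half_le_one_sub_pow {a : ℝ} {n : ℕ} (ha : a ≤ 1) (h : n * a ≤ 1 / 2) :
    1 / 2 ≤ (1 - a) ^ n := by
  have := one_add_mul_le_pow (a := -a) (by linarith) n
  rw [← sub_eq_add_neg] at this
  linarith

lemma add_pow_le_two_mul_pow_add {a b : ℝ} (ha : 0 ≤ a) (hb : 0 ≤ b) (n : ℕ) :
    (a + b) ^ n ≤ (2 * a) ^ n + (2 * b) ^ n := by
  rcases le_total a b with h | h
  · have : (a + b) ^ n ≤ (2 * b) ^ n := by gcongr; linarith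
    have : 0 ≤ (2 * a) ^ n := by positivity
    linarith
  · have : (a + b) ^ n ≤ (2 * a) ^ n := by gcongr; linarith
    have : 0 ≤ (2 * b) ^ n := by positivity
    linarith

namespace SAModel

variable {d : ℕ} {X Ω : Type*} [MeasurableSpace X] [mΩ : MeasurableSpace Ω] {q : ℕ}
  {ν : Measure Ω} {P : Kernel X X} [IsMarkovKernel P] {π : Measure X} {L₁ L₂ μ α : ℝ} {β : ℝ≥0∞} {g : Euc d → X → Euc d} {θstar : Euc d}
  {x : ℕ → Ω → X} {ξ : ℕ → Euc d → Ω → Euc d} {θ₀ : Ω → Euc d} {τ : ℕ} {ε A : ℝ}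

/-- Source of all later smallness conditions on α: A ≥ 1000(q+1), L ≤ L² and μ ≤ 1 turn the
definition of ε into bounds on ταL and τα. -/
lemma mul_le_sq_of_eq (h : SAModel q ν P π L₁ L₂ μ α β g θstar x ξ θ₀ τ)
    (hL : 1 ≤ L₁ + L₂) (hμ1 : μ ≤ 1) (hA : A = 1000 * (q + 1) ^ 2 * 9 ^ q)
    (hεA : ε ^ 2 * μ = A * (α * τ * (L₁ + L₂) ^ 2)) :
    1000 * (q + 1) * (τ * (α * (L₁ + L₂))) ≤ ε ^ 2 ∧ 1000 * (q + 1) * (τ * α) ≤ ε ^ 2 := by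
  have hα := h.α_pos
  have h9 : (1 : ℝ) ≤ 9 ^ q := one_le_pow₀ (by norm_num)
  have hq : (0 : ℝ) ≤ q := q.cast_nonneg
  have hA1 : 1000 * ((q : ℝ) + 1) ≤ A := by
    rw [hA]
    calc 1000 * ((q : ℝ) + 1) = 1000 * (q + 1) * 1 := by ring
      _ ≤ 1000 * (q + 1) ^ 2 * 9 ^ q := by gcongr; nlinarith
  have hA0 : 0 ≤ A := le_trans (by positivity) hA1
  have h1 : α * τ * (L₁ + L₂) ≤ α * τ * (L₁ + L₂) ^ 2 := by gcongr; nlinarith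
  have h2 : α * τ ≤ α * τ * (L₁ + L₂) := le_mul_of_one_le_right (by positivity) hL
  have h3 : ε ^ 2 * μ ≤ ε ^ 2 * 1 := by gcongr
  have h4 : A * (α * τ * (L₁ + L₂)) ≤ A * (α * τ * (L₁ + L₂) ^ 2) := by gcongr
  have h5 : 1000 * (q + 1) * (α * τ * (L₁ + L₂)) ≤ A * (α * τ * (L₁ + L₂)) := by gcongr
  have h6 : 1000 * (q + 1) * (α * τ) ≤ 1000 * (q + 1) * (α * τ * (L₁ + L₂)) := by gcongr
  constructor
  · calc _ = 1000 * (q + 1) * (α * τ * (L₁ + L₂)) := by ring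
      _ ≤ _ := by linarith
  · calc _ = 1000 * (q + 1) * (α * τ) := by ring
      _ ≤ _ := by linarith

variable [IsProbabilityMeasure ν] [IsProbabilityMeasure π]

/-- Either the error is already of order `ε`, or it contracts. -/
lemma eLpNorm_half_pow_le_max (h : SAModel q ν P π L₁ L₂ μ α β g θstar x ξ θ₀ τ)
    (hL : 1 ≤ L₁ + L₂) (hμ1 : μ ≤ 1) (hε : 0 < ε) (hε1 : ε ≤ 1)
    (hA : A = 1000 * (q + 1) ^ 2 * 9 ^ q) (hεA : ε ^ 2 * μ = A * (α * τ * (L₁ + L₂) ^ 2))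
    (h0 : eLpNorm (fun ω => θ₀ ω - θstar) ((2 * (q + 1) : ℕ) : ℝ≥0∞) ν ≠ ∞)
    {n : ℕ} (hn : 1 ≤ n) :
    eLpNorm (fun ω => saHalfIterate g α β x ξ θ₀ (n + τ) ω - θstar)
        ((2 * (q + 1) : ℕ) : ℝ≥0∞) ν ^ (2 * (q + 1))
      ≤ max (ENNReal.ofReal (1 - α * μ)
          * eLpNorm (fun ω => saIterate g α β x ξ θ₀ (n + τ) ω - θstar)
            ((2 * (q + 1) : ℕ) : ℝ≥0∞) ν ^ (2 * (q + 1)))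
        (ENNReal.ofReal ((3 * (ε * (1 + ‖θstar‖))) ^ (2 * (q + 1)))) := by
  have hα := h.α_pos
  have hL₁ := h.smooth.L₁_pos
  have hL₂ := h.noise.L₂_pos
  have hμ := h.monotone.μ_pos
  have hτ : (1 : ℝ) ≤ τ := by exact_mod_cast h.one_le_τ
  have hq : (0 : ℝ) ≤ q := q.cast_nonneg
  have hK0 : 0 < 1 + ‖θstar‖ := by positivity
  obtain ⟨s1, s2⟩ := h.mul_le_sq_of_eq hL hμ1 hA hεA
  have hS : 0 < α * (L₁ + L₂) := by positivity
  have hτS : 0 ≤ τ * (α * (L₁ + L₂)) := by positivity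
  have hSτ : α * (L₁ + L₂) ≤ τ * (α * (L₁ + L₂)) := le_mul_of_one_le_left hS.le hτ
  have s3 : 1000 * (τ * (α * (L₁ + L₂))) ≤ ε ^ 2 := by
    refine le_trans ?_ s1
    have : 0 ≤ q * (τ * (α * (L₁ + L₂))) := by positivity
    linarith
  have hε2 : ε ^ 2 ≤ ε := by nlinarith
  have hfin := h.eLpNorm_ne_top h0 (n + τ)
  set u := (eLpNorm (fun ω => saIterate g α β x ξ θ₀ (n + τ) ω - θstar)
    ((2 * (q + 1) : ℕ) : ℝ≥0∞) ν).toReal with hu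
  have hu0 : 0 ≤ u := ENNReal.toReal_nonneg
  have hU := ENNReal.ofReal_toReal hfin
  rw [← hu] at hU
  -- Below the threshold u ≤ εK one step adds at most αL(u + K) ≤ 2εK, hence the radius 3εK. Above
  -- it, the drift estimate applies.
  rcases le_total u (ε * (1 + ‖θstar‖)) with hcase | hcase
  · refine le_max_of_le_right ?_
    rw [ENNReal.ofReal_pow (by positivity)]
    refine pow_le_pow_left' ((h.eLpNorm_half_le hu0 hU.ge).trans (ENNReal.ofReal_le_ofReal ?_)) _
    have h1 : α * (L₁ + L₂) * (u + (1 + ‖θstar‖)) ≤ ε * (2 * (1 + ‖θstar‖)) := by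
      gcongr
      · linarith
      · have : ε * (1 + ‖θstar‖) ≤ 1 * (1 + ‖θstar‖) := by gcongr
        linarith
    linarith
  · refine le_max_of_le_left ?_
    have hu1 : 0 < u := lt_of_lt_of_le (by positivity) hcase
    have hb : ε * (u + (1 + ‖θstar‖)) ≤ 2 * u := by nlinarith
    have hD : 4 * τ * (α * (L₁ + L₂)) * (u + (1 + ‖θstar‖)) ≤ u := by
      calc 4 * τ * (α * (L₁ + L₂)) * (u + (1 + ‖θstar‖))
          ≤ (ε / 2) * (u + (1 + ‖θstar‖)) := by gcongr; linarith
        _ ≤ u := by linarith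
    have hw : α * (L₁ + L₂) * (u + (1 + ‖θstar‖)) ≤ u := by
      refine le_trans (mul_le_mul_of_nonneg_right ?_ (by positivity)) hD
      linarith
    have hαμ : 2 * (q + 1) * α * μ ≤ 1 := by
      have h1 : α ≤ τ * α := le_mul_of_one_le_left hα.le hτ
      have h2 : (q + 1) * α ≤ (q + 1) * (τ * α) := by gcongr
      have h3 : (q + 1) * α * μ ≤ (q + 1) * α * 1 := by gcongr
      linarith
    have := h.eLpNorm_half_pow_le n hu1 (by positivity) hD rfl hw hαμ hU.ge
      (h.eLpNorm_iterate_sub_le h0 hu0 hn (by linarith) hU.ge)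
    refine this.trans ((ENNReal.ofReal_le_ofReal (drift_bound_le q hK0 hα hL₁ hL₂ hL hτ hμ hε hε1
      hA hεA hcase)).trans (le_of_eq ?_))
    rw [← hU, ← ENNReal.ofReal_pow hu0, ← ENNReal.ofReal_mul]
    have h1 : α ≤ τ * α := le_mul_of_one_le_left hα.le hτ
    have h2 : 0 ≤ q * (τ * α) := by positivity
    have h3 : α * μ ≤ α * 1 := by gcongr
    linarith

/-- Iterating the dichotomy: each contraction multiplies the first entry of the maximum by 1 - αμ
and leaves the second entry an upper bound. -/
lemma eLpNorm_half_pow_le_max_pow (h : SAModel q ν P π L₁ L₂ μ α β g θstar x ξ θ₀ τ)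
    (hL : 1 ≤ L₁ + L₂) (hμ1 : μ ≤ 1) (hε : 0 < ε) (hε1 : ε ≤ 1)
    (hA : A = 1000 * (q + 1) ^ 2 * 9 ^ q) (hεA : ε ^ 2 * μ = A * (α * τ * (L₁ + L₂) ^ 2))
    {u : ℝ} (hu : 0 ≤ u) (h0 : eLpNorm (fun ω => θ₀ ω - θstar) ((2 * (q + 1) : ℕ) : ℝ≥0∞) ν
      ≤ ENNReal.ofReal u) (i : ℕ) :
    eLpNorm (fun ω => saHalfIterate g α β x ξ θ₀ (i + τ) ω - θstar)
        ((2 * (q + 1) : ℕ) : ℝ≥0∞) ν ^ (2 * (q + 1))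
      ≤ ENNReal.ofReal (max ((1 - α * μ) ^ i * (2 * u + ε * (1 + ‖θstar‖)) ^ (2 * (q + 1)))
        ((3 * (ε * (1 + ‖θstar‖))) ^ (2 * (q + 1)))) := by
  have hα := h.α_pos
  have hL₁ := h.smooth.L₁_pos
  have hL₂ := h.noise.L₂_pos
  have hμ := h.monotone.μ_pos
  have hτ : (1 : ℝ) ≤ τ := by exact_mod_cast h.one_le_τ
  have hq : (0 : ℝ) ≤ q := q.cast_nonneg
  have hK0 : 0 < 1 + ‖θstar‖ := by positivity
  obtain ⟨s1, s2⟩ := h.mul_le_sq_of_eq hL hμ1 hA hεA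
  have hS : 0 < α * (L₁ + L₂) := by positivity
  have hSτ : α * (L₁ + L₂) ≤ τ * (α * (L₁ + L₂)) := le_mul_of_one_le_left hS.le hτ
  have s3 : 1000 * (τ * (α * (L₁ + L₂))) ≤ ε ^ 2 := by
    refine le_trans ?_ s1
    have : 0 ≤ q * (τ * (α * (L₁ + L₂))) := by positivity
    linarith
  have hε2 : ε ^ 2 ≤ ε := by nlinarith
  have hαμ0 : 0 ≤ 1 - α * μ := by
    have h1 : α ≤ τ * α := le_mul_of_one_le_left hα.le hτ
    have h2 : 0 ≤ q * (τ * α) := by positivity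
    have h3 : α * μ ≤ α * 1 := by gcongr
    linarith
  have hαμ1 : 1 - α * μ ≤ 1 := by
    have : 0 < α * μ := by positivity
    linarith
  induction i with
  -- The base case uses the growth estimate from θ₀, because the displacement bound cannot start at
  -- time 0, before any projection. The induction step looks back to time i + 1 ≥ 1.
  | zero =>
    rw [zero_add]
    have h1 := (h.eLpNorm_iterate_le_of_init hu h0 τ (by linarith)).2
    rw [pow_zero, one_mul]
    refine le_trans ?_ (ENNReal.ofReal_le_ofReal (le_max_left _ _))
    rw [ENNReal.ofReal_pow (by positivity)]
    refine pow_le_pow_left' (h1.trans (ENNReal.ofReal_le_ofReal ?_)) _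
    have h2 : 2 * (τ + 1) * (α * (L₁ + L₂)) * (u + (1 + ‖θstar‖)) ≤ ε * (u + (1 + ‖θstar‖)) := by
      gcongr
      linarith
    have h3 : ε * u ≤ 1 * u := by gcongr
    linarith
  | succ i ih =>
    refine (h.eLpNorm_half_pow_le_max hL hμ1 hε hε1 hA hεA (h0.trans_lt ENNReal.ofReal_lt_top).ne
      (by omega : 1 ≤ i + 1)).trans ?_
    refine max_le ?_ (ENNReal.ofReal_le_ofReal (le_max_right _ _))
    have e : i + 1 + τ = i + τ + 1 := by omega
    have h1 := (pow_le_pow_left' (h.eLpNorm_succ_le (i + τ)) (2 * (q + 1))).trans ih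
    rw [e]
    refine (mul_le_mul_right h1 _).trans ?_
    rw [← ENNReal.ofReal_mul hαμ0, mul_max_of_nonneg _ _ hαμ0]
    refine ENNReal.ofReal_le_ofReal (max_le_max (le_of_eq (by ring)) ?_)
    exact mul_le_of_le_one_left (by positivity) hαμ1

/-- The moment bound, with the error term expressed through `ε`. -/
lemma eLpNorm_half_pow_le_add (h : SAModel q ν P π L₁ L₂ μ α β g θstar x ξ θ₀ τ)
    (hL : 1 ≤ L₁ + L₂) (hμ1 : μ ≤ 1) (hε : 0 < ε) (hε1 : ε ≤ 1)
    (hA : A = 1000 * (q + 1) ^ 2 * 9 ^ q) (hεA : ε ^ 2 * μ = A * (α * τ * (L₁ + L₂) ^ 2))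
    {k : ℕ} (hk : τ ≤ k) :
    eLpNorm (fun ω => saHalfIterate g α β x ξ θ₀ k ω - θstar)
        ((2 * (q + 1) : ℕ) : ℝ≥0∞) ν ^ (2 * (q + 1))
      ≤ ENNReal.ofReal (2 * 4 ^ (2 * (q + 1)) * (1 - α * μ) ^ (k + 1))
          * eLpNorm (fun ω => θ₀ ω - θstar) ((2 * (q + 1) : ℕ) : ℝ≥0∞) ν ^ (2 * (q + 1))
        + ENNReal.ofReal (2 * (3 * (ε * (1 + ‖θstar‖))) ^ (2 * (q + 1))) := by
  have hα := h.α_pos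
  have hμ := h.monotone.μ_pos
  have hτ : (1 : ℝ) ≤ τ := by exact_mod_cast h.one_le_τ
  have hK0 : 0 < 1 + ‖θstar‖ := by positivity
  have hαμ : (τ + 1) * (α * μ) ≤ 1 / 2 := by
    have s2 := (h.mul_le_sq_of_eq hL hμ1 hA hεA).2
    have h1 : α ≤ τ * α := le_mul_of_one_le_left hα.le hτ
    have h2 : 0 ≤ q * (τ * α) := by positivity
    have h3 : (τ + 1) * (α * μ) ≤ (τ + 1) * (α * 1) := by gcongr
    have h4 : ε ^ 2 ≤ 1 := pow_le_one₀ hε.le hε1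
    linarith
  have hαμ1 : α * μ ≤ 1 / 2 := by
    have : 0 < τ * (α * μ) := by positivity
    linarith
  have hc : 0 < 1 - α * μ := by linarith
  -- If the initial moment is infinite, so is the right-hand side, its coefficient being positive.
  by_cases h0 : eLpNorm (fun ω => θ₀ ω - θstar) ((2 * (q + 1) : ℕ) : ℝ≥0∞) ν = ∞
  · rw [h0, ENNReal.top_pow (by omega), ENNReal.mul_top, top_add]
    · exact le_top
    · rw [ne_eq, ENNReal.ofReal_eq_zero, not_le]
      positivity
  set u := (eLpNorm (fun ω => θ₀ ω - θstar) ((2 * (q + 1) : ℕ) : ℝ≥0∞) ν).toReal with hu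
  have hu0 : 0 ≤ u := ENNReal.toReal_nonneg
  have hU := ENNReal.ofReal_toReal h0
  rw [← hu] at hU
  obtain ⟨i, rfl⟩ := Nat.exists_eq_add_of_le' hk
  refine (h.eLpNorm_half_pow_le_max_pow hL hμ1 hε hε1 hA hεA hu0 hU.ge i).trans ?_
  rw [← hU, ← ENNReal.ofReal_pow hu0, ← ENNReal.ofReal_mul (by positivity),
    ← ENNReal.ofReal_add (by positivity) (by positivity)]
  refine ENNReal.ofReal_le_ofReal (max_le ?_ ?_)
  · have h1 := half_le_one_sub_pow (a := α * μ) (n := τ + 1) (by linarith) (by push_cast; exact hαμ)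
    have h2 := add_pow_le_two_mul_pow_add (by positivity : 0 ≤ 2 * u)
      (by positivity : 0 ≤ ε * (1 + ‖θstar‖)) (2 * (q + 1))
    have h3 : (2 * (ε * (1 + ‖θstar‖))) ^ (2 * (q + 1))
        ≤ (3 * (ε * (1 + ‖θstar‖))) ^ (2 * (q + 1)) := by
      gcongr; norm_num
    have h4 : 0 ≤ (3 * (ε * (1 + ‖θstar‖))) ^ (2 * (q + 1)) := by positivity
    have h5 : (1 - α * μ) ^ i ≤ 1 := pow_le_one₀ hc.le (by nlinarith)
    -- Passing from exponent i to k + 1 = i + τ + 1 costs only a factor 2, by Bernoulli with (τ +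
    -- 1)αμ ≤ 1/2.
    have h6 : (1 - α * μ) ^ i ≤ 2 * (1 - α * μ) ^ (i + τ + 1) := by
      rw [add_assoc, pow_add]
      have : 0 < (1 - α * μ) ^ i := by positivity
      nlinarith
    calc (1 - α * μ) ^ i * (2 * u + ε * (1 + ‖θstar‖)) ^ (2 * (q + 1))
        ≤ (1 - α * μ) ^ i * ((2 * (2 * u)) ^ (2 * (q + 1))
          + (3 * (ε * (1 + ‖θstar‖))) ^ (2 * (q + 1))) := by gcongr; linarith
      _ = (1 - α * μ) ^ i * (2 * (2 * u)) ^ (2 * (q + 1))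
          + (1 - α * μ) ^ i * (3 * (ε * (1 + ‖θstar‖))) ^ (2 * (q + 1)) := mul_add _ _ _
      _ ≤ 2 * (1 - α * μ) ^ (i + τ + 1) * (2 * (2 * u)) ^ (2 * (q + 1))
          + 1 * (3 * (ε * (1 + ‖θstar‖))) ^ (2 * (q + 1)) := by gcongr
      _ ≤ _ := by
          rw [show 2 * (2 * u) = 4 * u by ring, mul_pow 4 u]
          linarith
  · have h4 : 0 ≤ (3 * (ε * (1 + ‖θstar‖))) ^ (2 * (q + 1)) := by positivity
    have h5 : 0 ≤ 2 * 4 ^ (2 * (q + 1)) * (1 - α * μ) ^ (i + τ + 1) * u ^ (2 * (q + 1)) := by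
      positivity
    linarith

end SAModel

end

/-! ### Choice of constants and conclusion -/

theorem mainTheorem3 (p : ℕ) (hp : 1 ≤ p) :
    ∃ cp c₁ c₂ : ℝ, 0 < cp ∧ cp ≤ 1 ∧ 0 < c₁ ∧ 0 < c₂ ∧
      ∀ d : ℕ, ∃ s : Measure (Euc d) → Euc d → ℝ → ℝ → ℝ≥0,
        ∀ (X : Type u) [MeasurableSpace X] (Ω : Type v) [MeasurableSpace Ω]
          (ν : Measure Ω) [IsProbabilityMeasure ν]
          (P : Kernel X X) [IsMarkovKernel P] (π : Measure X) [IsProbabilityMeasure π]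
          (r R L₁ L₂ μ α : ℝ) (β : ℝ≥0∞) (g : Euc d → X → Euc d) (θstar : Euc d)
          (x : ℕ → Ω → X) (ξ : ℕ → Euc d → Ω → Euc d) (θ₀ : Ω → Euc d),
          UniformlyErgodic P π r R →
          (∀ θ, Measurable (g θ)) →
          SmoothLinearGrowth g L₁ →
          StronglyMonotone (meanUpdate g π) μ →
          μ ≤ 1 - r →
          meanUpdate g π θstar = 0 →
          1 ≤ L₁ + L₂ →
          0 < α →
          2 * ‖θstar‖ₑ ≤ β →
          Measurable θ₀ →
          IsMarkovChain ν P (history x (saIterate g α β x ξ θ₀) ξ) x →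
          NoiseAssumption ν (history x (saIterate g α β x ξ θ₀) ξ) ξ θstar p L₂ →
          α * mixingTime P π α * (L₁ + L₂) ^ 2 ≤ cp * μ →
          ∀ k : ℕ, mixingTime P π α ≤ k →
            ∫⁻ ω, ‖saIterate g α β x ξ θ₀ (k + 1) ω - θstar‖ₑ ^ (2 * p) ∂ν
              ≤ ∫⁻ ω, ‖saHalfIterate g α β x ξ θ₀ k ω - θstar‖ₑ ^ (2 * p) ∂ν ∧
            ∫⁻ ω, ‖saHalfIterate g α β x ξ θ₀ k ω - θstar‖ₑ ^ (2 * p) ∂ν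
              ≤ ENNReal.ofReal (c₁ * (1 - α * μ) ^ (k + 1))
                  * ∫⁻ ω, ‖θ₀ ω - θstar‖ₑ ^ (2 * p) ∂ν
                + ENNReal.ofReal (c₂ * (α * mixingTime P π α) ^ p
                    * s (ν.map θ₀) θstar (L₁ + L₂) μ) := by
  obtain ⟨q, rfl⟩ := Nat.exists_eq_add_of_le' hp
  set A : ℝ := 1000 * (q + 1) ^ 2 * 9 ^ q with hA
  have hA1 : 1 ≤ A := by
    have h9 : (1 : ℝ) ≤ 9 ^ q := one_le_pow₀ (by norm_num)
    have hq : (0 : ℝ) ≤ q := q.cast_nonneg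
    calc (1 : ℝ) = 1 * 1 ^ 2 * 1 := by norm_num
      _ ≤ 1000 * (q + 1) ^ 2 * 9 ^ q := by gcongr <;> linarith
  have hA0 : 0 < A := by linarith
  -- The threshold 1/A is what forces ε ≤ 1. The last constant comes from 2(3εK)^{2p} = 2(9ε²)^p
  -- K^{2p} with ε² = AατL²/μ; the remaining factors K^{2p}(L²/μ)^p form s, which can be taken
  -- independent of the law of θ₀.
  refine ⟨1 / A, 2 * 4 ^ (2 * (q + 1)), 2 * (9 * A) ^ (q + 1), by positivity,
    (div_le_one hA0).2 hA1, by positivity, by positivity, fun d => ?_⟩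
  refine ⟨fun _ θs L m => Real.toNNReal ((1 + ‖θs‖) ^ (2 * (q + 1)) * (L ^ 2 / m) ^ (q + 1)), ?_⟩
  intro X _ Ω _ ν _ P _ π _ r R L₁ L₂ μ α β g θstar x ξ θ₀ herg hg hs hm hμr h0 hL hα hβ hθ₀ hx hξ
    hstep k hk
  obtain ⟨hτ1, htv⟩ := one_le_mixingTime_and_tvDist_le herg hα
  have hball : ‖θstar‖ₑ ≤ β := le_trans (le_mul_of_one_le_left (by simp) one_le_two) hβ
  have h : SAModel q ν P π L₁ L₂ μ α β g θstar x ξ θ₀ (mixingTime P π α) :=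
    ⟨hτ1, htv, hg, hs, hm, h0, hα, hball, hθ₀, hx, hξ⟩
  have hμ := hm.μ_pos
  have hτ : (1 : ℝ) ≤ mixingTime P π α := by exact_mod_cast hτ1
  generalize mixingTime P π α = τ at *
  rw [lintegral_enorm_pow_eq, lintegral_enorm_pow_eq, lintegral_enorm_pow_eq]
  refine ⟨pow_le_pow_left' (h.eLpNorm_succ_le k) _, ?_⟩
  set e2 : ℝ := A * (α * τ * (L₁ + L₂) ^ 2) / μ with he2
  have he0 : 0 < e2 := by positivity
  have he1 : e2 ≤ 1 := by
    rw [he2, div_le_one hμ]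
    calc A * (α * τ * (L₁ + L₂) ^ 2) ≤ A * (1 / A * μ) := by gcongr
      _ = μ := by field_simp
  have hsq : Real.sqrt e2 ^ 2 = e2 := Real.sq_sqrt he0.le
  -- Here ε is the square root of `e2`, and μ ≤ 1 follows from μ ≤ 1 - r with r ≥ 0.
  have main := h.eLpNorm_half_pow_le_add hL (by linarith [herg.r_nonneg]) (Real.sqrt_pos.2 he0)
    (Real.sqrt_le_one.2 he1) hA (by rw [hsq, he2]; field_simp) hk
  refine main.trans (le_of_eq ?_)
  congr 2
  rw [Real.coe_toNNReal _ (by positivity)]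
  have e : (3 * (Real.sqrt e2 * (1 + ‖θstar‖))) ^ (2 * (q + 1))
      = (9 * e2) ^ (q + 1) * (1 + ‖θstar‖) ^ (2 * (q + 1)) := by
    rw [← mul_assoc, mul_pow _ (1 + ‖θstar‖), pow_mul (3 * Real.sqrt e2), mul_pow 3, hsq]
    norm_num
  have e' : 9 * e2 = 9 * A * (α * τ) * ((L₁ + L₂) ^ 2 / μ) := by rw [he2]; ring
  rw [e, e', mul_pow, mul_pow]
  ring
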